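/- Let $A,B$ be finite-dimensional quantum systems and let $\rho_{AB}$ be a state (positive semidefinite operator of trace one) on $\mathcal H_A\otimes\mathcal H_B$, with reduced states $\rho_A=\operatorname{tr}_B\rho_{AB}$ and $\rho_B=\operatorname{tr}_A\rho_{AB}$. Logarithms are to base $2$. For $\alpha\in(0,1)\cup(1,\infty)$, a state $\rho$ and a positive semidefinite operator $\sigma$, the sandwiched Rényi divergence is $$D^*_\alpha(\rho\|\sigma)=\frac{1}{\alpha-1}\log\operatorname{tr}\Big(\sigma^{\frac{1-\alpha}{2\alpha}}\rho\,\sigma^{\frac{1-\alpha}{2\alpha}}\Big)^{\alpha}$$ if either $\alpha>1$ and $\operatorname{supp}\rho\subseteq\operatorname{supp}\sigma$, or $\alpha<1$ and $\operatorname{supp}\rho\not\perp\operatorname{supp}\sigma$ (negative powers being taken on the support), and $D^*_\alpha(\rho\|\sigma)=+\infty$ otherwise. The sandwiched Rényi mutual information is $$I^*_\alpha(A:B)_\rho=\min_{\sigma_B}D^*_\alpha(\rho_{AB}\|\rho_A\otimes\sigma_B),$$ the minimum being over all states $\sigma_B$ on $\mathcal H_B$ and understood as an infimum in $[-\infty,+\infty]$;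 for $\alpha=1$ it is given by its limiting value, the quantum mutual information $I^*_1(A:B)_\rho=\operatorname{tr}\big(\rho_{AB}(\log\rho_{AB}-\log(\rho_A\otimes\rho_B))\big)$, with logarithms taken on the supports. Then for every $\lambda\in(-1,1)$ the quantity $I^*_{1/(1-\lambda)}(A:B)_\rho$ is finite, and the function $$g(\lambda)=\lambda\, I^*_{\frac{1}{1-\lambda}}(A:B)_\rho$$ is convex and continuous on $(-1,1)$. -/

import Mathlib

open scoped ComplexOrder Kronecker

noncomputable section

namespace QInfo

/-- A quantum state (density operator) on the finite-dimensional Hilbert space `ℂⁿ`: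
a positive semidefinite matrix of trace one. -/
def IsState {n : Type*} [Fintype n] (ρ : Matrix n n ℂ) : Prop :=
  ρ.PosSemidef ∧ ρ.trace = 1

/-- The support of a positive semidefinite operator, that is, its range (equivalently, the
orthogonal complement of its kernel). -/
def supp {n : Type*} [Fintype n] [DecidableEq n] (X : Matrix n n ℂ) :
    Submodule ℂ (EuclideanSpace ℂ n) :=
  LinearMap.range (Matrix.toEuclideanLin X)

/-- The real power `X ^ s` of a positive semidefinite matrix, by functional calculus. For `s ≠ 0`
the eigenvalue `0` is sent to `0`, so negative powers are taken on the support of `X`. -/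
def mpow {n : Type*} [Fintype n] [DecidableEq n] (X : Matrix n n ℂ) (s : ℝ) : Matrix n n ℂ :=
  cfc (fun x : ℝ => x ^ s) X

/-- The base-two logarithm of a positive semidefinite matrix, taken on its support
(the eigenvalue `0` is sent to `0`). -/
def mlog {n : Type*} [Fintype n] [DecidableEq n] (X : Matrix n n ℂ) : Matrix n n ℂ :=
  cfc (Real.logb 2) X

open Classical in
/-- The Umegaki relative entropy `D(ρ‖σ)`. -/
def relEntropy {n : Type*} [Fintype n] [DecidableEq n] (ρ σ : Matrix n n ℂ) : EReal :=
  if supp ρ ≤ supp σ then (((ρ * (mlog ρ - mlog σ)).trace.re : ℝ) : EReal) else ⊤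

/-- The trace `tr (σ^((1-α)/(2α)) ρ σ^((1-α)/(2α)))^α` (a nonnegative real number). -/
def sandwichedTrace {n : Type*} [Fintype n] [DecidableEq n] (α : ℝ) (ρ σ : Matrix n n ℂ) : ℝ :=
  (mpow (mpow σ ((1 - α) / (2 * α)) * ρ * mpow σ ((1 - α) / (2 * α))) α).trace.re

open Classical in
/-- The sandwiched Rényi divergence `D*_α(ρ‖σ)` of order `α ∈ (0,1) ∪ (1,∞)`, extended to `α = 1`
by its limit, the relative entropy. -/
def sandwichedDiv {n : Type*} [Fintype n] [DecidableEq n] (α : ℝ) (ρ σ : Matrix n n ℂ) : EReal :=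
  if α = 1 then relEntropy ρ σ
  else if (1 < α ∧ supp ρ ≤ supp σ) ∨ (α < 1 ∧ ¬ supp ρ ⟂ supp σ) then
    ((1 / (α - 1) * Real.logb 2 (sandwichedTrace α ρ σ) : ℝ) : EReal)
  else ⊤

/-- The reduced state `ρ_A = tr_B ρ_AB`. -/
def margA {A B : Type*} [Fintype B] (ρ : Matrix (A × B) (A × B) ℂ) : Matrix A A ℂ :=
  fun a a' => ∑ b, ρ (a, b) (a', b)

/-- The reduced state `ρ_B = tr_A ρ_AB`. -/
def margB {A B : Type*} [Fintype A] (ρ : Matrix (A × B) (A × B) ℂ) : Matrix B B ℂ :=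
  fun b b' => ∑ a, ρ (a, b) (a, b')

open Classical in
/-- The sandwiched Rényi mutual information `I*_α(A:B)_ρ = min_{σ_B} D*_α(ρ_AB ‖ ρ_A ⊗ σ_B)`, the
minimum being over all states of `B`, extended to `α = 1` by its limit, the quantum mutual
information `D(ρ_AB ‖ ρ_A ⊗ ρ_B)`. -/
def sandwichedMI {A B : Type*} [Fintype A] [DecidableEq A] [Fintype B] [DecidableEq B]
    (α : ℝ) (ρ : Matrix (A × B) (A × B) ℂ) : EReal :=
  if α = 1 then relEntropy ρ (margA ρ ⊗ₖ margB ρ)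
  else ⨅ (σ : Matrix B B ℂ) (_ : IsState σ), sandwichedDiv α ρ (margA ρ ⊗ₖ σ)

end QInfo

end

/-!
# Convexity of the sandwiched Rényi mutual information

The norm `renyiNorm` is logarithmically convex in its order by complex interpolation. For negative
`t` the optimisation over states is a supremum of such norms; for positive `t` a minimax argument
turns the infimum into a supremum of dual norms of the same kind.
-/

/-! Write t for λ, so α = 1/(1-t), and let R = √ρ. Since M Mᴴ and Mᴴ M have the same spectrum,
t·D*_α(ρ‖D) is, when finite, the logarithm of the Schatten quasi-norm ‖R D^(-t) R‖ of index 1/(1-t),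
which is `renyiNorm D R (-t)`. Hence g is the logarithm of `optimalNorm`: an infimum over σ for t >
0, a supremum for t < 0 because the factor 1/t reverses the order, and log 1 at t = 0.

For fixed D the logarithm of ‖R D^s R‖ of index 1/(1+s) is convex in s on (-1, 1)
(`weightedNorm_interp`): it is the square of the norm of D^(s/2) R of index 2/(1+s) > 1, to which
Hölder duality and the three lines theorem apply. Suprema of log-convex functions are log-convex,
which settles t < 0.

An infimum need not be log-convex, so for t > 0 it is turned into a supremum. By Hölder the norm is
the supremum over τ of tr(τ^t R (ρ_A^(-t) ⊗ σ^(-t)) R). This is bilinear in Y = τ^t and X = σ^(-t),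
which range over convex sets, the first one compact, so a minimax theorem exchanges the
optimisations. By reverse Hölder the inner infimum over σ is a quasi-norm of index 1/(1+t) of R read
as a map from B to A ⊗ C, where C carries τ. This is again of the interpolated form
(`dualNorm_le_renyiNorm`, `exists_renyiNorm_le`).

The halves are glued at 0 by log-convexity for a single σ dominating ρ, whose norm at s = 0 is tr ρ
= 1 (`optimalNorm_junction`). The same estimate keeps the infimum positive, hence g finite.
Continuity is that of a convex function on an open interval. -/

noncomputable section

namespace QInfo

open Matrix

set_option linter.unusedSectionVars false

/-! ### Diagonalization, singular values and Hölder inequalities for sums -/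

section Diagonalization

variable {m n : Type*} [Fintype m] [DecidableEq m] [Fintype n] [DecidableEq n]

/-- The matrix `U diag(d) Uᴴ`. -/
def conjDiag (U : Matrix m n ℂ) (d : n → ℝ) : Matrix m m ℂ :=
  U * diagonal (fun i => (d i : ℂ)) * Uᴴ

lemma conjDiag_apply (U : Matrix m n ℂ) (d : n → ℝ) (i j : m) :
    conjDiag U d i j = ∑ k, U i k * (d k : ℂ) * star (U j k) := by
  simp [conjDiag, mul_apply, diagonal_apply]

lemma mul_conjDiag_mul {l : Type*} [Fintype l] [DecidableEq l] (V : Matrix l m ℂ)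
    (U : Matrix m n ℂ) (d : n → ℝ) :
    V * conjDiag U d * Vᴴ = conjDiag (V * U) d := by
  simp [conjDiag, Matrix.mul_assoc]

lemma conjDiag_mul_conjDiag {U : Matrix n n ℂ} (hU : Uᴴ * U = 1) (d e : n → ℝ) :
    conjDiag U d * conjDiag U e = conjDiag U (fun i => d i * e i) := by
  have : conjDiag U d * conjDiag U e
      = U * diagonal (fun i => (d i : ℂ)) * (Uᴴ * U) * diagonal (fun i => (e i : ℂ)) * Uᴴ := by
    simp only [conjDiag, Matrix.mul_assoc]
  rw [this, hU, Matrix.mul_one, Matrix.mul_assoc U, diagonal_mul_diagonal]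
  simp [conjDiag]

lemma conjDiag_one {U : Matrix n n ℂ} (hU : Uᴴ * U = 1) : conjDiag U (fun _ => 1) = 1 := by
  simpa [conjDiag] using mul_eq_one_comm.mp hU

lemma conjDiag_isHermitian (U : Matrix m n ℂ) (d : n → ℝ) : (conjDiag U d).IsHermitian := by
  simp only [IsHermitian, conjDiag, conjTranspose_mul, conjTranspose_conjTranspose,
    diagonal_conjTranspose, Matrix.mul_assoc]
  congr 3
  ext i
  simp

lemma conjDiag_posSemidef (U : Matrix m n ℂ) {d : n → ℝ} (hd : ∀ i, 0 ≤ d i) :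
    (conjDiag U d).PosSemidef := by
  apply PosSemidef.mul_mul_conjTranspose_same
  rw [posSemidef_diagonal_iff]
  intro i
  exact_mod_cast hd i

lemma exists_eq_conjDiag {X : Matrix n n ℂ} (hX : X.IsHermitian) :
    ∃ (U : Matrix n n ℂ) (d : n → ℝ), Uᴴ * U = 1 ∧ X = conjDiag U d ∧ d = hX.eigenvalues := by
  refine ⟨hX.eigenvectorUnitary, hX.eigenvalues, ?_, ?_, rfl⟩
  · exact Unitary.coe_star_mul_self hX.eigenvectorUnitary
  · conv_lhs => rw [hX.spectral_theorem]
    rw [Unitary.conjStarAlgAut_apply]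
    rfl

lemma exists_eq_conjDiag_of_posSemidef {X : Matrix n n ℂ} (hX : X.PosSemidef) :
    ∃ (U : Matrix n n ℂ) (d : n → ℝ), Uᴴ * U = 1 ∧ X = conjDiag U d ∧ ∀ i, 0 ≤ d i := by
  obtain ⟨U, d, hU, h, hd⟩ := exists_eq_conjDiag hX.1
  exact ⟨U, d, hU, h, fun i => hd ▸ hX.eigenvalues_nonneg i⟩

lemma aeval_conjDiag {U : Matrix n n ℂ} (hU : Uᴴ * U = 1) (d : n → ℝ) (q : Polynomial ℝ) :
    Polynomial.aeval (conjDiag U d) q = conjDiag U (fun i => q.eval (d i)) := by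
  have hU' : U * Uᴴ = 1 := mul_eq_one_comm.mp hU
  induction q using Polynomial.induction_on' with
  | add p q hp hq =>
    rw [map_add, hp, hq]
    simp only [conjDiag, Polynomial.eval_add, Complex.ofReal_add]
    rw [← Matrix.add_mul, ← Matrix.mul_add, diagonal_add]
  | monomial k a =>
    have hpow : ∀ k : ℕ, (conjDiag U d) ^ k = conjDiag U (fun i => d i ^ k) := by
      intro k
      induction k with
      | zero => simp [conjDiag_one hU]
      | succ k ih =>
        rw [pow_succ, ih, conjDiag_mul_conjDiag hU]
        simp only [pow_succ]
    rw [Polynomial.aeval_monomial, hpow]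
    ext i j
    simp only [Algebra.algebraMap_eq_smul_one, Matrix.smul_mul, Matrix.one_mul,
      Matrix.smul_apply, conjDiag_apply, Polynomial.eval_monomial, Finset.smul_sum]
    refine Finset.sum_congr rfl fun k _ => ?_
    simp only [Complex.real_smul, Complex.ofReal_mul]
    ring

/-- A polynomial agreeing with `f` both on the entries of `d` and on the chosen eigenvalues reduces
the functional calculus to algebra, so the two lists never have to be matched up to permutation. -/
lemma cfc_conjDiag {U : Matrix n n ℂ} (hU : Uᴴ * U = 1) (d : n → ℝ) (f : ℝ → ℝ) :
    cfc f (conjDiag U d) = conjDiag U (fun i => f (d i)) := by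
  have hX := conjDiag_isHermitian U d
  classical
  set s : Finset ℝ := Finset.univ.image d ∪ Finset.univ.image hX.eigenvalues
  set q : Polynomial ℝ := Lagrange.interpolate s id f
  have hq : ∀ x ∈ s, q.eval x = f x := fun x hx =>
    Lagrange.eval_interpolate_at_node f (Set.injOn_id _) hx
  have h1 : cfc f (conjDiag U d) = cfc (fun x => q.eval x) (conjDiag U d) := by
    apply cfc_congr
    intro x hx
    rw [hX.spectrum_real_eq_range_eigenvalues] at hx
    obtain ⟨i, rfl⟩ := hx
    exact (hq _ (by simp [s])).symm
  rw [h1, cfc_polynomial q _ hX.isSelfAdjoint, aeval_conjDiag hU]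
  congr 1
  ext i
  exact hq _ (by simp [s])

lemma mpow_conjDiag {U : Matrix n n ℂ} (hU : Uᴴ * U = 1) (d : n → ℝ) (p : ℝ) :
    mpow (conjDiag U d) p = conjDiag U (fun i => d i ^ p) :=
  cfc_conjDiag hU d _

lemma trace_conjDiag {U : Matrix n n ℂ} (hU : Uᴴ * U = 1) (d : n → ℝ) :
    (conjDiag U d).trace = ((∑ i, d i : ℝ) : ℂ) := by
  rw [conjDiag, Matrix.mul_assoc, trace_mul_comm, Matrix.mul_assoc, hU, Matrix.mul_one,
    trace_diagonal]
  simp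

/-- The trace of the `p`-th power of a positive semidefinite matrix. -/
def powTrace (p : ℝ) (X : Matrix n n ℂ) : ℝ := (mpow X p).trace.re

lemma powTrace_conjDiag {U : Matrix n n ℂ} (hU : Uᴴ * U = 1) (d : n → ℝ) (p : ℝ) :
    powTrace p (conjDiag U d) = ∑ i, d i ^ p := by
  rw [powTrace, mpow_conjDiag hU, trace_conjDiag hU, Complex.ofReal_re]

lemma powTrace_nonneg (p : ℝ) {X : Matrix n n ℂ} (hX : X.PosSemidef) : 0 ≤ powTrace p X := by
  obtain ⟨U, d, hU, rfl, hd⟩ := exists_eq_conjDiag_of_posSemidef hX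
  rw [powTrace_conjDiag hU]
  exact Finset.sum_nonneg fun i _ => Real.rpow_nonneg (hd i) p

lemma powTrace_one {X : Matrix n n ℂ} (hX : X.PosSemidef) : powTrace 1 X = X.trace.re := by
  obtain ⟨U, d, hU, rfl, hd⟩ := exists_eq_conjDiag_of_posSemidef hX
  simp [powTrace_conjDiag hU, trace_conjDiag hU]

lemma unitary_mul {U V : Matrix n n ℂ} (hU : Uᴴ * U = 1) (hV : Vᴴ * V = 1) :
    (U * V)ᴴ * (U * V) = 1 := by
  rw [conjTranspose_mul, Matrix.mul_assoc, ← Matrix.mul_assoc Uᴴ, hU, Matrix.one_mul, hV]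

lemma powTrace_conj_unitary (p : ℝ) {X : Matrix n n ℂ} (hX : X.PosSemidef) {V : Matrix n n ℂ}
    (hV : Vᴴ * V = 1) : powTrace p (V * X * Vᴴ) = powTrace p X := by
  obtain ⟨U, d, hU, rfl, hd⟩ := exists_eq_conjDiag_of_posSemidef hX
  rw [mul_conjDiag_mul, powTrace_conjDiag hU, powTrace_conjDiag (unitary_mul hV hU)]

/-- The two products share their characteristic polynomial, and the power trace is a function of its
roots. -/
lemma powTrace_mul_conjTranspose_comm (p : ℝ) (M : Matrix n n ℂ) :
    powTrace p (M * Mᴴ) = powTrace p (Mᴴ * M) := by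
  have key : ∀ (X : Matrix n n ℂ), X.IsHermitian →
      powTrace p X = (X.charpoly.roots.map fun z => z.re ^ p).sum := by
    intro X hX
    obtain ⟨U, d, hU, h, hd⟩ := exists_eq_conjDiag hX
    conv_lhs => rw [h]
    rw [powTrace_conjDiag hU, hX.roots_charpoly_eq_eigenvalues, Multiset.map_map, hd]
    simp
  rw [key _ (posSemidef_self_mul_conjTranspose M).1, key _ (posSemidef_conjTranspose_mul_self M).1,
    charpoly_mul_comm]

/-- For unitary `U` and `V` the squared overlaps form a doubly stochastic matrix, so trace
inequalities for noncommuting matrices become weighted inequalities between eigenvalues. -/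
lemma re_trace_conjDiag_mul_conjDiag (U V : Matrix n n ℂ) (x y : n → ℝ) :
    (conjDiag U x * conjDiag V y).trace.re = ∑ i, ∑ j, ‖(Uᴴ * V) i j‖ ^ 2 * x i * y j := by
  have h1 : (conjDiag U x * conjDiag V y).trace
      = (diagonal (fun i => (x i : ℂ)) * (Uᴴ * V) * diagonal (fun i => (y i : ℂ)) *
        (Uᴴ * V)ᴴ).trace := by
    rw [conjDiag, conjDiag, conjTranspose_mul, conjTranspose_conjTranspose]
    simp only [Matrix.mul_assoc]
    rw [trace_mul_comm]
    simp only [Matrix.mul_assoc]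
  rw [h1, trace, Complex.re_sum]
  refine Finset.sum_congr rfl fun i _ => ?_
  rw [diag_apply, mul_apply, Complex.re_sum]
  refine Finset.sum_congr rfl fun j _ => ?_
  rw [mul_diagonal, diagonal_mul, conjTranspose_apply]
  have : (x i : ℂ) * (Uᴴ * V) i j * (y j : ℂ) * star ((Uᴴ * V) i j)
      = ((‖(Uᴴ * V) i j‖ ^ 2 * x i * y j : ℝ) : ℂ) := by
    have := Complex.mul_conj' ((Uᴴ * V) i j)
    push_cast
    rw [← this]
    simp only [RCLike.star_def]
    ring
  rw [this, Complex.ofReal_re]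

lemma sum_norm_sq_col {U : Matrix m n ℂ} (hU : Uᴴ * U = 1) (j : n) : ∑ i, ‖U i j‖ ^ 2 = 1 := by
  have h := congrFun (congrFun hU j) j
  rw [mul_apply, one_apply_eq] at h
  have h2 : ((∑ i, ‖U i j‖ ^ 2 : ℝ) : ℂ) = 1 := by
    rw [← h]
    push_cast
    refine Finset.sum_congr rfl fun i _ => ?_
    rw [conjTranspose_apply, RCLike.star_def, Complex.conj_mul']
  exact_mod_cast h2

lemma sum_norm_sq_row {U : Matrix n n ℂ} (hU : Uᴴ * U = 1) (i : n) : ∑ j, ‖U i j‖ ^ 2 = 1 := by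
  have h : (Uᴴ)ᴴ * Uᴴ = 1 := by simpa using mul_eq_one_comm.mp hU
  simpa using sum_norm_sq_col h i

lemma star_dotProduct_self (v : m → ℂ) : star v ⬝ᵥ v = ((∑ i, ‖v i‖ ^ 2 : ℝ) : ℂ) := by
  simp only [dotProduct, Pi.star_apply, RCLike.star_def, Complex.conj_mul']
  push_cast
  rfl

/-- **Bessel's inequality** for the columns of `V`, orthogonal and of norm at most one. -/
lemma sum_norm_sq_conjTranspose_mulVec_le {V : Matrix m n ℂ} {e : n → ℝ}
    (hV : Vᴴ * V = diagonal (fun i => (e i : ℂ))) (he : ∀ i, e i ≤ 1) (x : m → ℂ) :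
    ∑ j, ‖(Vᴴ *ᵥ x) j‖ ^ 2 ≤ ∑ i, ‖x i‖ ^ 2 := by
  set y := Vᴴ *ᵥ x with hy
  have h0 : 0 ≤ ∑ i, ‖(x - V *ᵥ y) i‖ ^ 2 := Finset.sum_nonneg fun i _ => by positivity
  have h1 : star (x - V *ᵥ y) ⬝ᵥ (x - V *ᵥ y)
      = star x ⬝ᵥ x - star y ⬝ᵥ y - star y ⬝ᵥ y + star y ⬝ᵥ (diagonal (fun i => (e i : ℂ)) *ᵥ y) := by
    have hxV : star x ⬝ᵥ (V *ᵥ y) = star y ⬝ᵥ y := by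
      rw [hy, star_mulVec, conjTranspose_conjTranspose, dotProduct_mulVec]
    have hVx : star (V *ᵥ y) ⬝ᵥ x = star y ⬝ᵥ y := by
      rw [star_mulVec, ← dotProduct_mulVec]
    have hVV : star (V *ᵥ y) ⬝ᵥ (V *ᵥ y) = star y ⬝ᵥ (diagonal (fun i => (e i : ℂ)) *ᵥ y) := by
      rw [star_mulVec, ← dotProduct_mulVec, mulVec_mulVec, hV]
    rw [star_sub, sub_dotProduct, dotProduct_sub, dotProduct_sub, hxV, hVx, hVV]
    ring
  have h2 : star y ⬝ᵥ (diagonal (fun i => (e i : ℂ)) *ᵥ y) = ((∑ i, e i * ‖y i‖ ^ 2 : ℝ) : ℂ) := by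
    simp only [dotProduct, mulVec_diagonal, Pi.star_apply, RCLike.star_def]
    push_cast
    refine Finset.sum_congr rfl fun i _ => ?_
    rw [← Complex.conj_mul']
    ring
  rw [star_dotProduct_self, star_dotProduct_self, star_dotProduct_self, h2] at h1
  have h3 : ∑ i, ‖(x - V *ᵥ y) i‖ ^ 2 = ∑ i, ‖x i‖ ^ 2 - ∑ i, ‖y i‖ ^ 2 - ∑ i, ‖y i‖ ^ 2
      + ∑ i, e i * ‖y i‖ ^ 2 := by exact_mod_cast h1
  have h4 : ∑ i, e i * ‖y i‖ ^ 2 ≤ ∑ i, ‖y i‖ ^ 2 :=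
    Finset.sum_le_sum fun i _ => mul_le_of_le_one_left (by positivity) (he i)
  linarith

/-- Singular value decomposition, with the left singular vectors of singular value zero set to
zero. -/
lemma exists_singular_decomposition (M : Matrix m n ℂ) :
    ∃ (C : Matrix n n ℂ) (γ : n → ℝ) (V : Matrix m n ℂ) (e : n → ℝ), Cᴴ * C = 1 ∧
      (∀ i, 0 ≤ γ i) ∧ Mᴴ * M = conjDiag C γ ∧
      M * C = V * diagonal (fun i => ((Real.sqrt (γ i) : ℝ) : ℂ)) ∧
      Vᴴ * V = diagonal (fun i => (e i : ℂ)) ∧ (∀ i, e i ≤ 1) ∧ (∀ i, γ i ≠ 0 → e i = 1) ∧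
      ∀ j, γ j = 0 → ∀ i, V i j = 0 := by
  obtain ⟨C, γ, hC, hM, hγ⟩ := exists_eq_conjDiag_of_posSemidef
    (posSemidef_conjTranspose_mul_self M)
  have hMC : (M * C)ᴴ * (M * C) = diagonal (fun i => (γ i : ℂ)) := by
    rw [conjTranspose_mul, Matrix.mul_assoc, ← Matrix.mul_assoc Mᴴ, hM, conjDiag]
    simp only [Matrix.mul_assoc, hC, Matrix.mul_one]
    rw [← Matrix.mul_assoc, hC, Matrix.one_mul]
  -- The inverse of √0 is 0, so the columns at singular value zero vanish and `e` is the indicator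
  -- of the nonzero ones.
  refine ⟨C, γ, M * C * diagonal (fun i => (((Real.sqrt (γ i))⁻¹ : ℝ) : ℂ)),
    fun i => if γ i = 0 then 0 else 1, hC, hγ, hM, ?_, ?_, ?_, ?_, ?_⟩
  · rw [Matrix.mul_assoc, diagonal_mul_diagonal]
    ext i j
    rw [mul_diagonal]
    by_cases h : γ j = 0
    · have h1 := congrFun (congrFun hMC j) j
      rw [mul_apply, diagonal_apply_eq, h] at h1
      have h2 : ((∑ i, ‖(M * C) i j‖ ^ 2 : ℝ) : ℂ) = ((0 : ℝ) : ℂ) := by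
        rw [← h1]
        push_cast
        refine Finset.sum_congr rfl fun i _ => ?_
        rw [conjTranspose_apply, RCLike.star_def, Complex.conj_mul']
      have h3 : ∑ i, ‖(M * C) i j‖ ^ 2 = 0 := by exact_mod_cast h2
      rw [Finset.sum_eq_zero_iff_of_nonneg (fun i _ => by positivity)] at h3
      have h4 : (M * C) i j = 0 := by simpa using h3 i (Finset.mem_univ i)
      simp [h4]
    · have : Real.sqrt (γ j) ≠ 0 := by
        rw [Real.sqrt_ne_zero']
        exact lt_of_le_of_ne (hγ j) (Ne.symm h)
      rw [← Complex.ofReal_mul, inv_mul_cancel₀ this]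
      simp
  · have hD : (diagonal (fun i => (((Real.sqrt (γ i))⁻¹ : ℝ) : ℂ)))ᴴ
        = diagonal (fun i => (((Real.sqrt (γ i))⁻¹ : ℝ) : ℂ)) := by
      rw [diagonal_conjTranspose]
      congr 1
      ext i
      simp
    rw [conjTranspose_mul, hD, Matrix.mul_assoc, ← Matrix.mul_assoc (M * C)ᴴ, hMC,
      diagonal_mul_diagonal, diagonal_mul_diagonal]
    congr 1
    ext i
    by_cases h : γ i = 0
    · simp [h]
    · have h1 : Real.sqrt (γ i) ≠ 0 := by
        rw [Real.sqrt_ne_zero']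
        exact lt_of_le_of_ne (hγ i) (Ne.symm h)
      simp only [if_neg h]
      rw [← Complex.ofReal_mul, ← Complex.ofReal_mul]
      congr 1
      have h2 := Real.mul_self_sqrt (hγ i)
      field_simp
      rw [sq, h2]
  · intro i
    dsimp only
    split_ifs <;> norm_num
  · intro i hi
    simp [hi]
  · intro j hj i
    simp [hj]

lemma sum_rpow_mul_rpow_le {ι : Type*} (s : Finset ι) {F G : ι → ℝ} (hF : ∀ i ∈ s, 0 ≤ F i)
    (hG : ∀ i ∈ s, 0 ≤ G i) {θ : ℝ} (h0 : 0 < θ) (h1 : θ < 1) :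
    ∑ i ∈ s, F i ^ θ * G i ^ (1 - θ) ≤ (∑ i ∈ s, F i) ^ θ * (∑ i ∈ s, G i) ^ (1 - θ) := by
  have hpq : Real.HolderConjugate (1 / θ) (1 / (1 - θ)) := by
    rw [Real.holderConjugate_iff]
    refine ⟨by rw [lt_div_iff₀ h0]; linarith, by simp⟩
  have h := Real.inner_le_Lp_mul_Lq_of_nonneg s hpq (f := fun i => F i ^ θ)
    (g := fun i => G i ^ (1 - θ)) (fun i hi => Real.rpow_nonneg (hF i hi) _)
    (fun i hi => Real.rpow_nonneg (hG i hi) _)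
  refine h.trans (le_of_eq ?_)
  rw [one_div_one_div, one_div_one_div]
  congr 2
  · refine Finset.sum_congr rfl fun i hi => ?_
    rw [← Real.rpow_mul (hF i hi), mul_one_div_cancel h0.ne', Real.rpow_one]
  · refine Finset.sum_congr rfl fun i hi => ?_
    rw [← Real.rpow_mul (hG i hi), mul_one_div_cancel (by linarith), Real.rpow_one]

/-- Hölder over pairs, the weight being split as S = S^θ · S^(1-θ); the row and column bounds then
remove it from each factor. -/
lemma sum_substochastic_rpow_mul_rpow_le {S : m → n → ℝ} (hS : ∀ i j, 0 ≤ S i j)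
    (hr : ∀ i, ∑ j, S i j ≤ 1) (hc : ∀ j, ∑ i, S i j ≤ 1) {x : m → ℝ} {y : n → ℝ}
    (hx : ∀ i, 0 ≤ x i) (hy : ∀ j, 0 ≤ y j) {θ : ℝ} (h0 : 0 < θ) (h1 : θ < 1) :
    ∑ i, ∑ j, S i j * x i ^ θ * y j ^ (1 - θ) ≤ (∑ i, x i) ^ θ * (∑ j, y j) ^ (1 - θ) := by
  have h := sum_rpow_mul_rpow_le (Finset.univ : Finset (m × n))
    (F := fun p => S p.1 p.2 * x p.1) (G := fun p => S p.1 p.2 * y p.2)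
    (fun p _ => mul_nonneg (hS _ _) (hx _)) (fun p _ => mul_nonneg (hS _ _) (hy _)) h0 h1
  rw [Fintype.sum_prod_type, Fintype.sum_prod_type, Fintype.sum_prod_type_right] at h
  have hl : ∀ i j, (S i j * x i) ^ θ * (S i j * y j) ^ (1 - θ)
      = S i j * x i ^ θ * y j ^ (1 - θ) := by
    intro i j
    rw [Real.mul_rpow (hS _ _) (hx _), Real.mul_rpow (hS _ _) (hy _)]
    have : S i j ^ θ * S i j ^ (1 - θ) = S i j := by
      rw [← Real.rpow_add_of_nonneg (hS _ _) h0.le (by linarith)]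
      simp
    calc _ = (S i j ^ θ * S i j ^ (1 - θ)) * x i ^ θ * y j ^ (1 - θ) := by ring
      _ = _ := by rw [this]
  simp only [hl] at h
  refine h.trans ?_
  have hx' : ∑ i, ∑ j, S i j * x i ≤ ∑ i, x i := Finset.sum_le_sum fun i _ => by
    rw [← Finset.sum_mul]
    exact mul_le_of_le_one_left (hx i) (hr i)
  have hy' : ∑ j, ∑ i, S i j * y j ≤ ∑ j, y j := Finset.sum_le_sum fun j _ => by
    rw [← Finset.sum_mul]
    exact mul_le_of_le_one_left (hy j) (hc j)
  refine mul_le_mul (Real.rpow_le_rpow ?_ hx' h0.le) (Real.rpow_le_rpow ?_ hy' (by linarith)) ?_ ?_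
  · exact Finset.sum_nonneg fun i _ => Finset.sum_nonneg fun j _ => mul_nonneg (hS _ _) (hx _)
  · exact Finset.sum_nonneg fun i _ => Finset.sum_nonneg fun j _ => mul_nonneg (hS _ _) (hy _)
  · exact Real.rpow_nonneg
      (Finset.sum_nonneg fun i _ => Finset.sum_nonneg fun j _ => mul_nonneg (hS _ _) (hy _)) _
  · exact Real.rpow_nonneg (Finset.sum_nonneg fun i _ => hx i) _

end Diagonalization

/-! ### Complex interpolation of the weighted norms -/

section Interpolation

variable {m n : Type*} [Fintype m] [DecidableEq m] [Fintype n] [DecidableEq n]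

/-- **Hölder's inequality** for Schatten norms, `M` being paired with `V diag(w ^ ((1 - s) / 2))`,
where the columns of `V` are orthogonal and of norm at most one. -/
lemma norm_sum_rpow_mul_le (M V : Matrix m n ℂ) {e : n → ℝ}
    (hV : Vᴴ * V = diagonal (fun i => (e i : ℂ))) (he : ∀ i, e i ≤ 1) {w : n → ℝ}
    (hw : ∀ j, 0 ≤ w j) (hw1 : ∑ j, w j ≤ 1) {s : ℝ} (hs : s ∈ Set.Ioo (-1 : ℝ) 1) :
    ‖∑ j, ((w j ^ ((1 - s) / 2) : ℝ) : ℂ) * (Vᴴ * M) j j‖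
      ≤ powTrace (1 / (1 + s)) (Mᴴ * M) ^ ((1 + s) / 2) := by
  obtain ⟨hs0, hs1⟩ := hs
  obtain ⟨C, γ, V₂, e₂, hC, hγ, hM, hMC, hV₂, he₂, -, -⟩ := exists_singular_decomposition M
  have hM' : M = V₂ * diagonal (fun i => ((Real.sqrt (γ i) : ℝ) : ℂ)) * Cᴴ := by
    rw [← hMC, Matrix.mul_assoc, mul_eq_one_comm.mp hC, Matrix.mul_one]
  set a := Vᴴ * V₂ with ha
  have hentry : ∀ j, (Vᴴ * M) j j = ∑ k, a j k * ((Real.sqrt (γ k) : ℝ) : ℂ) * star (C j k) := by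
    intro j
    rw [hM', ← Matrix.mul_assoc, ← Matrix.mul_assoc, ← ha, mul_apply]
    simp [mul_diagonal]
  -- The product ‖a j k‖ ‖C j k‖ is at most this mean of squares, which is substochastic: `C` is
  -- unitary and `a` obeys Bessel's inequality in both indices.
  set S : n → n → ℝ := fun k j => (‖a j k‖ ^ 2 + ‖C j k‖ ^ 2) / 2 with hSdef
  have hV₂' : ∀ k, ∑ i, ‖V₂ i k‖ ^ 2 ≤ 1 := by
    intro k
    have h := congrFun (congrFun hV₂ k) k
    rw [mul_apply, diagonal_apply_eq] at h
    have h2 : ((∑ i, ‖V₂ i k‖ ^ 2 : ℝ) : ℂ) = (e₂ k : ℂ) := by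
      rw [← h]
      push_cast
      refine Finset.sum_congr rfl fun i _ => ?_
      rw [conjTranspose_apply, RCLike.star_def, Complex.conj_mul']
    have h3 : ∑ i, ‖V₂ i k‖ ^ 2 = e₂ k := by exact_mod_cast h2
    rw [h3]
    exact he₂ k
  have hV' : ∀ k, ∑ i, ‖V i k‖ ^ 2 ≤ 1 := by
    intro k
    have h := congrFun (congrFun hV k) k
    rw [mul_apply, diagonal_apply_eq] at h
    have h2 : ((∑ i, ‖V i k‖ ^ 2 : ℝ) : ℂ) = (e k : ℂ) := by
      rw [← h]
      push_cast
      refine Finset.sum_congr rfl fun i _ => ?_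
      rw [conjTranspose_apply, RCLike.star_def, Complex.conj_mul']
    have h3 : ∑ i, ‖V i k‖ ^ 2 = e k := by exact_mod_cast h2
    rw [h3]
    exact he k
  have hac : ∀ k, ∑ j, ‖a j k‖ ^ 2 ≤ 1 := by
    intro k
    refine le_trans ?_ (hV₂' k)
    exact sum_norm_sq_conjTranspose_mulVec_le hV he (fun i => V₂ i k)
  have har : ∀ j, ∑ k, ‖a j k‖ ^ 2 ≤ 1 := by
    intro j
    refine le_trans ?_ (hV' j)
    refine le_trans (le_of_eq ?_)
      (sum_norm_sq_conjTranspose_mulVec_le hV₂ he₂ (fun i => V i j))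
    refine Finset.sum_congr rfl fun k _ => ?_
    congr 1
    rw [← norm_star (a j k), ← conjTranspose_apply, ha, conjTranspose_mul,
      conjTranspose_conjTranspose]
    rfl
  have hSnn : ∀ k j, 0 ≤ S k j := fun k j => by positivity
  have hSr : ∀ k, ∑ j, S k j ≤ 1 := by
    intro k
    simp only [hSdef]
    rw [← Finset.sum_div, Finset.sum_add_distrib, sum_norm_sq_col hC k]
    linarith [hac k]
  have hSc : ∀ j, ∑ k, S k j ≤ 1 := by
    intro j
    simp only [hSdef]
    rw [← Finset.sum_div, Finset.sum_add_distrib, sum_norm_sq_row hC j]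
    linarith [har j]
  have hH := sum_substochastic_rpow_mul_rpow_le hSnn hSr hSc
    (x := fun k => γ k ^ (1 / (1 + s))) (y := w) (fun k => Real.rpow_nonneg (hγ k) _) hw
    (θ := (1 + s) / 2) (by linarith) (by linarith)
  have hx : ∀ k, (γ k ^ (1 / (1 + s))) ^ ((1 + s) / 2) = Real.sqrt (γ k) := by
    intro k
    rw [← Real.rpow_mul (hγ k), Real.sqrt_eq_rpow]
    congr 1
    have : (1 : ℝ) + s ≠ 0 := by linarith
    field_simp
  have hθ : 1 - (1 + s) / 2 = (1 - s) / 2 := by ring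
  simp only [hx, hθ] at hH
  have hfin : (∑ j, w j) ^ ((1 - s) / 2) ≤ 1 :=
    Real.rpow_le_one (Finset.sum_nonneg fun j _ => hw j) hw1 (by linarith)
  rw [hM, powTrace_conjDiag hC]
  have hnn : 0 ≤ (∑ i, γ i ^ (1 / (1 + s))) ^ ((1 + s) / 2) :=
    Real.rpow_nonneg (Finset.sum_nonneg fun i _ => Real.rpow_nonneg (hγ i) _) _
  refine le_trans ?_ (hH.trans (mul_le_of_le_one_right hnn hfin))
  rw [Finset.sum_comm]
  refine (norm_sum_le _ _).trans (Finset.sum_le_sum fun j _ => ?_)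
  rw [norm_mul, hentry, Complex.norm_real, Real.norm_of_nonneg (Real.rpow_nonneg (hw j) _)]
  have h1 : ‖∑ k, a j k * ((Real.sqrt (γ k) : ℝ) : ℂ) * star (C j k)‖
      ≤ ∑ k, S k j * Real.sqrt (γ k) := by
    refine (norm_sum_le _ _).trans (Finset.sum_le_sum fun k _ => ?_)
    rw [norm_mul, norm_mul, norm_star, Complex.norm_real,
      Real.norm_of_nonneg (Real.sqrt_nonneg _)]
    have : ‖a j k‖ * ‖C j k‖ ≤ S k j := by
      simp only [hSdef]
      linarith [two_mul_le_add_sq ‖a j k‖ ‖C j k‖]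
    calc _ = (‖a j k‖ * ‖C j k‖) * Real.sqrt (γ k) := by ring
      _ ≤ _ := mul_le_mul_of_nonneg_right this (Real.sqrt_nonneg _)
  calc _ ≤ w j ^ ((1 - s) / 2) * ∑ k, S k j * Real.sqrt (γ k) :=
        mul_le_mul_of_nonneg_left h1 (Real.rpow_nonneg (hw j) _)
    _ = _ := by
      rw [Finset.mul_sum]
      exact Finset.sum_congr rfl fun k _ => by ring

/-- The quasi-norm `‖Rᴴ diag(d ^ s) R‖` of Schatten index `1 / (1 + s)`. -/
def weightedNorm (d : m → ℝ) (R : Matrix m n ℂ) (s : ℝ) : ℝ :=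
  powTrace (1 / (1 + s)) (Rᴴ * diagonal (fun i => ((d i ^ s : ℝ) : ℂ)) * R) ^ (1 + s)

lemma weighted_posSemidef {d : m → ℝ} (hd : ∀ i, 0 ≤ d i) (R : Matrix m n ℂ) (s : ℝ) :
    (Rᴴ * diagonal (fun i => ((d i ^ s : ℝ) : ℂ)) * R).PosSemidef := by
  apply PosSemidef.conjTranspose_mul_mul_same
  rw [posSemidef_diagonal_iff]
  intro i
  exact_mod_cast Real.rpow_nonneg (hd i) s

lemma weightedNorm_nonneg {d : m → ℝ} (hd : ∀ i, 0 ≤ d i) (R : Matrix m n ℂ) (s : ℝ) :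
    0 ≤ weightedNorm d R s :=
  Real.rpow_nonneg (powTrace_nonneg _ (weighted_posSemidef hd R s)) _

lemma norm_cexp_mul_ofReal (z : ℂ) (a : ℝ) : ‖Complex.exp (z * a)‖ = Real.exp (z.re * a) := by
  rw [Complex.norm_exp]
  simp

/-- The exponential sum interpolating the Schatten norms. -/
def interpSum (c : m → n → ℂ) (a : m → ℝ) (b : n → ℝ) (z : ℂ) : ℂ :=
  ∑ j, ∑ i, c i j * Complex.exp (z * a i) * Complex.exp ((1 - z) * b j)

lemma interpSum_differentiable (c : m → n → ℂ) (a : m → ℝ) (b : n → ℝ) :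
    Differentiable ℂ (interpSum c a b) := by
  unfold interpSum
  fun_prop

lemma interpSum_bddAbove (c : m → n → ℂ) (a : m → ℝ) (b : n → ℝ) (l u : ℝ) :
    BddAbove ((norm ∘ interpSum c a b) '' Complex.HadamardThreeLines.verticalClosedStrip l u) := by
  set g : ℝ → ℝ := fun x => ∑ j, ∑ i, ‖c i j‖ * Real.exp (x * a i) * Real.exp ((1 - x) * b j)
  have hg : Continuous g := by fun_prop
  obtain ⟨B, hB⟩ := (isCompact_Icc (a := l) (b := u)).bddAbove_image hg.continuousOn
  refine ⟨B, ?_⟩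
  rintro _ ⟨z, hz, rfl⟩
  refine le_trans ?_ (hB ⟨z.re, hz, rfl⟩)
  refine (norm_sum_le _ _).trans (Finset.sum_le_sum fun j _ => ?_)
  refine (norm_sum_le _ _).trans (Finset.sum_le_sum fun i _ => ?_)
  rw [norm_mul, norm_mul, norm_cexp_mul_ofReal, norm_cexp_mul_ofReal]
  simp

lemma ofReal_rpow_eq_cexp {x : ℝ} (hx : 0 < x) (y : ℝ) :
    ((x ^ y : ℝ) : ℂ) = Complex.exp (y * Real.log x) := by
  rw [Real.rpow_def_of_pos hx, mul_comm]
  push_cast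
  rfl

/-- On the line Re z = s the sum is the Hölder pairing of D^(s/2) R C with V diag(w^((1-s)/2)). The
imaginary part of z only contributes phases, absorbed into `V` without changing Vᴴ V. -/
lemma norm_interpSum_le {d : m → ℝ} (hd : ∀ i, 0 < d i) (R V : Matrix m n ℂ) {C : Matrix n n ℂ}
    (hC : Cᴴ * C = 1) {e : n → ℝ} (hV : Vᴴ * V = diagonal (fun i => (e i : ℂ)))
    (he : ∀ i, e i ≤ 1) {w : n → ℝ} (hw : ∀ j, 0 ≤ w j) (hw1 : ∑ j, w j ≤ 1)
    (hVw : ∀ j, w j = 0 → ∀ i, V i j = 0) {z : ℂ} (hz : z.re ∈ Set.Ioo (-1 : ℝ) 1) :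
    ‖interpSum (fun i j => star (V i j) * (R * C) i j) (fun i => Real.log (d i) / 2)
      (fun j => Real.log (w j) / 2) z‖ ≤ weightedNorm d R z.re ^ (1 / 2 : ℝ) := by
  set s := z.re
  set u : m → ℂ := fun i => Complex.exp (z.im * Complex.I * (Real.log (d i) / 2 : ℝ))
  set v : n → ℂ := fun j => Complex.exp (-(z.im * Complex.I * (Real.log (w j) / 2 : ℝ)))
  have hu : ∀ i, star (u i) * u i = 1 := by
    intro i
    rw [RCLike.star_def, Complex.conj_mul', Complex.norm_exp]
    simp
  have hv : ∀ j, star (v j) * v j = 1 := by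
    intro j
    rw [RCLike.star_def, Complex.conj_mul', Complex.norm_exp]
    simp
  set V' : Matrix m n ℂ := fun i j => star (u i) * V i j * star (v j)
  set M' : Matrix m n ℂ := diagonal (fun i => ((d i ^ (s / 2) : ℝ) : ℂ)) * (R * C) with hM'
  have hV' : V'ᴴ * V' = diagonal (fun i => (e i : ℂ)) := by
    ext j k
    have h := congrFun (congrFun hV j) k
    rw [mul_apply] at h ⊢
    have h2 : ∑ i, V'ᴴ j i * V' i k = v j * (∑ i, Vᴴ j i * V i k) * star (v k) := by
      rw [Finset.mul_sum, Finset.sum_mul]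
      refine Finset.sum_congr rfl fun i _ => ?_
      change star (star (u i) * V i j * star (v j)) * (star (u i) * V i k * star (v k))
        = v j * (star (V i j) * V i k) * star (v k)
      simp only [star_mul', star_star]
      calc _ = (star (u i) * u i) * (v j * (star (V i j) * V i k) * star (v k)) := by ring
        _ = _ := by rw [hu, one_mul]
    rw [h2, h]
    by_cases hjk : j = k
    · subst hjk
      rw [diagonal_apply_eq]
      calc _ = (e j : ℂ) * (star (v j) * v j) := by ring
        _ = _ := by rw [hv, mul_one]
    · rw [diagonal_apply_ne _ hjk]
      simp
  have hMM : M'ᴴ * M' = Cᴴ * (Rᴴ * diagonal (fun i => ((d i ^ s : ℝ) : ℂ)) * R) * Cᴴᴴ := by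
    have hD : (diagonal (fun i => ((d i ^ (s / 2) : ℝ) : ℂ)))ᴴ
        = diagonal (fun i => ((d i ^ (s / 2) : ℝ) : ℂ)) := by
      rw [diagonal_conjTranspose]
      congr 1
      ext i
      simp
    have hDD : diagonal (fun i => ((d i ^ (s / 2) : ℝ) : ℂ))
        * diagonal (fun i => ((d i ^ (s / 2) : ℝ) : ℂ))
        = diagonal (fun i => ((d i ^ s : ℝ) : ℂ)) := by
      rw [diagonal_mul_diagonal]
      congr 1
      ext i
      rw [← Complex.ofReal_mul, ← Real.rpow_add (hd i), add_halves]
    rw [hM', conjTranspose_mul, hD, Matrix.mul_assoc, ← Matrix.mul_assoc (diagonal _), hDD,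
      conjTranspose_mul, conjTranspose_conjTranspose]
    simp only [Matrix.mul_assoc]
  have hH := norm_sum_rpow_mul_le M' V' hV' he hw hw1 hz
  have hC' : Cᴴᴴ * Cᴴ = 1 := by simpa using mul_eq_one_comm.mp hC
  rw [hMM, powTrace_conj_unitary _ (weighted_posSemidef (fun i => (hd i).le) R s) hC'] at hH
  have hexp : weightedNorm d R s ^ (1 / 2 : ℝ)
      = powTrace (1 / (1 + s)) (Rᴴ * diagonal (fun i => ((d i ^ s : ℝ) : ℂ)) * R)
        ^ ((1 + s) / 2) := by
    rw [weightedNorm, ← Real.rpow_mul (powTrace_nonneg _ (weighted_posSemidef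
      (fun i => (hd i).le) R s))]
    congr 1
    ring
  rw [hexp]
  refine le_trans (le_of_eq ?_) hH
  congr 1
  unfold interpSum
  refine Finset.sum_congr rfl fun j _ => ?_
  rw [mul_apply, Finset.mul_sum]
  refine Finset.sum_congr rfl fun i _ => ?_
  rw [conjTranspose_apply, hM', diagonal_mul]
  simp only [V', star_mul', star_star]
  -- As `Real.log 0 = 0`, the exponential is 1 and not 0 here; the vanishing column of `V`
  -- compensates.
  by_cases hj : w j = 0
  · simp [hVw j hj i]
  have hwj : 0 < w j := lt_of_le_of_ne (hw j) (Ne.symm hj)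
  have hz' : z = (s : ℂ) + z.im * Complex.I := (Complex.re_add_im z).symm
  have h1 : Complex.exp (z * (Real.log (d i) / 2 : ℝ)) = ((d i ^ (s / 2) : ℝ) : ℂ) * u i := by
    rw [ofReal_rpow_eq_cexp (hd i), ← Complex.exp_add]
    congr 1
    conv_lhs => rw [hz']
    push_cast
    ring
  have h2 : Complex.exp ((1 - z) * (Real.log (w j) / 2 : ℝ))
      = ((w j ^ ((1 - s) / 2) : ℝ) : ℂ) * v j := by
    rw [ofReal_rpow_eq_cexp hwj, ← Complex.exp_add]
    congr 1
    conv_lhs => rw [hz']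
    push_cast
    ring
  rw [h1, h2]
  ring

/-- **Complex interpolation**: `s ↦ log (weightedNorm d R s)` is convex on `(-1, 1)`. -/
theorem weightedNorm_interp {d : m → ℝ} (hd : ∀ i, 0 < d i) (R : Matrix m n ℂ) {l u s : ℝ}
    (hl : -1 < l) (hls : l ≤ s) (hsu : s ≤ u) (hu : u < 1) (hlu : l < u) :
    weightedNorm d R s
      ≤ weightedNorm d R l ^ ((u - s) / (u - l)) * weightedNorm d R u ^ ((s - l) / (u - l)) := by
  have hd0 : ∀ i, 0 ≤ d i := fun i => (hd i).le
  have hs1 : 0 < 1 + s := by linarith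
  set M : Matrix m n ℂ := diagonal (fun i => ((d i ^ (s / 2) : ℝ) : ℂ)) * R with hMdef
  have hMM : Mᴴ * M = Rᴴ * diagonal (fun i => ((d i ^ s : ℝ) : ℂ)) * R := by
    have hD : (diagonal (fun i => ((d i ^ (s / 2) : ℝ) : ℂ)))ᴴ
        = diagonal (fun i => ((d i ^ (s / 2) : ℝ) : ℂ)) := by
      rw [diagonal_conjTranspose]
      congr 1
      ext i
      simp
    have hDD : diagonal (fun i => ((d i ^ (s / 2) : ℝ) : ℂ))
        * diagonal (fun i => ((d i ^ (s / 2) : ℝ) : ℂ))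
        = diagonal (fun i => ((d i ^ s : ℝ) : ℂ)) := by
      rw [diagonal_mul_diagonal]
      congr 1
      ext i
      rw [← Complex.ofReal_mul, ← Real.rpow_add (hd i), add_halves]
    rw [hMdef, conjTranspose_mul, hD, Matrix.mul_assoc, ← Matrix.mul_assoc (diagonal _), hDD,
      Matrix.mul_assoc]
  obtain ⟨C, γ, V, e, hC, hγ, hMC, hMV, hV, he, he1, hV0⟩ := exists_singular_decomposition M
  set T := ∑ j, γ j ^ (1 / (1 + s)) with hT
  have hTnn : 0 ≤ T := Finset.sum_nonneg fun j _ => Real.rpow_nonneg (hγ j) _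
  have hWs : weightedNorm d R s = T ^ (1 + s) := by
    rw [weightedNorm, ← hMM, hMC, powTrace_conjDiag hC]
  have hRHS : 0 ≤ weightedNorm d R l ^ ((u - s) / (u - l))
      * weightedNorm d R u ^ ((s - l) / (u - l)) :=
    mul_nonneg (Real.rpow_nonneg (weightedNorm_nonneg hd0 _ _) _)
      (Real.rpow_nonneg (weightedNorm_nonneg hd0 _ _) _)
  rcases hTnn.eq_or_lt with h0 | hTpos
  · rw [hWs, ← h0, Real.zero_rpow hs1.ne']
    exact hRHS
  -- Hölder's extremiser at the point s: with these weights the pairing equals T^((1+s)/2), the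
  -- square root of the quasi-norm.
  set w : n → ℝ := fun j => γ j ^ (1 / (1 + s)) / T with hwdef
  have hw : ∀ j, 0 ≤ w j := fun j => div_nonneg (Real.rpow_nonneg (hγ j) _) hTnn
  have hw1 : ∑ j, w j ≤ 1 := by
    rw [hwdef, ← Finset.sum_div, div_self hTpos.ne']
  have hVw : ∀ j, w j = 0 → ∀ i, V i j = 0 := by
    intro j hj
    refine hV0 j ?_
    rcases div_eq_zero_iff.mp hj with h | h
    · exact ((Real.rpow_eq_zero_iff_of_nonneg (hγ j)).mp h).1
    · exact absurd h hTpos.ne'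
  set F := interpSum (fun i j => star (V i j) * (R * C) i j) (fun i => Real.log (d i) / 2)
      (fun j => Real.log (w j) / 2) with hF
  have h3 := Complex.HadamardThreeLines.norm_le_interp_of_mem_verticalClosedStrip'
    (f := F) (z := (s : ℂ)) (a := weightedNorm d R l ^ (1 / 2 : ℝ))
    (b := weightedNorm d R u ^ (1 / 2 : ℝ)) hlu
    (by simp [Complex.HadamardThreeLines.verticalClosedStrip, hls, hsu])
    (interpSum_differentiable _ _ _).diffContOnCl (interpSum_bddAbove _ _ _ _ _)
    (by
      intro z hz
      have hz' : z.re = l := hz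
      rw [← hz']
      exact norm_interpSum_le hd R V hC hV he hw hw1 hVw (by rw [hz']; constructor <;> linarith))
    (by
      intro z hz
      have hz' : z.re = u := hz
      rw [← hz']
      exact norm_interpSum_le hd R V hC hV he hw hw1 hVw (by rw [hz']; constructor <;> linarith))
  rw [Complex.ofReal_re] at h3
  have hFs : F s = ((T ^ ((1 + s) / 2) : ℝ) : ℂ) := by
    have hcol : ∀ j, ∑ i, star (V i j) * (R * C) i j * Complex.exp (s * (Real.log (d i) / 2 : ℝ))
        * Complex.exp ((1 - s) * (Real.log (w j) / 2 : ℝ))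
        = ((γ j ^ (1 / (1 + s)) * T ^ (-((1 - s) / 2)) : ℝ) : ℂ) := by
      intro j
      by_cases hj : γ j = 0
      · rw [hj, Real.zero_rpow (by positivity)]
        simp [hV0 j hj]
      have hγj : 0 < γ j := lt_of_le_of_ne (hγ j) (Ne.symm hj)
      have hwj : 0 < w j := div_pos (Real.rpow_pos_of_pos hγj _) hTpos
      have h1 : ∀ i, star (V i j) * (R * C) i j * Complex.exp (s * (Real.log (d i) / 2 : ℝ))
          = Vᴴ j i * (V i j * ((Real.sqrt (γ j) : ℝ) : ℂ)) := by
        intro i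
        have h2 := congrFun (congrFun hMV i) j
        rw [hMdef, Matrix.mul_assoc, diagonal_mul, mul_diagonal] at h2
        rw [← h2, ofReal_rpow_eq_cexp (hd i), conjTranspose_apply]
        push_cast
        ring_nf
      rw [← Finset.sum_mul, Finset.sum_congr rfl fun i _ => h1 i]
      have h4 : ∑ i, Vᴴ j i * (V i j * ((Real.sqrt (γ j) : ℝ) : ℂ)) = ((Real.sqrt (γ j) : ℝ) : ℂ) := by
        have h5 := congrFun (congrFun hV j) j
        rw [mul_apply, diagonal_apply_eq, he1 j hj] at h5
        simp only [← mul_assoc]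
        rw [← Finset.sum_mul, h5]
        simp
      have h6 : Complex.exp ((1 - s) * (Real.log (w j) / 2 : ℝ))
          = ((w j ^ ((1 - s) / 2) : ℝ) : ℂ) := by
        rw [ofReal_rpow_eq_cexp hwj]
        push_cast
        ring_nf
      rw [h4, h6, ← Complex.ofReal_mul]
      congr 1
      rw [hwdef]
      dsimp only
      rw [Real.div_rpow (Real.rpow_nonneg (hγ j) _) hTnn, ← Real.rpow_mul (hγ j),
        Real.sqrt_eq_rpow, Real.rpow_neg hTnn, ← div_eq_mul_inv, ← mul_div_assoc,
        ← Real.rpow_add hγj]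
      congr 2
      field_simp
      ring
    rw [hF]
    unfold interpSum
    rw [Finset.sum_congr rfl fun j _ => hcol j, ← Complex.ofReal_sum]
    congr 1
    rw [← Finset.sum_mul, ← hT]
    nth_rewrite 1 [← Real.rpow_one T]
    rw [← Real.rpow_add hTpos]
    congr 1
    ring
  rw [hFs, Complex.norm_real, Real.norm_of_nonneg (Real.rpow_nonneg hTnn _)] at h3
  -- The three lines bound concerns the norms of D^(s/2) R; squaring it gives the quasi-norms.
  have h7 := Real.rpow_le_rpow (Real.rpow_nonneg hTnn _) h3 (z := 2) (by norm_num)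
  have hn1 := weightedNorm_nonneg hd0 R l
  have hn2 := weightedNorm_nonneg hd0 R u
  rw [hWs]
  rw [← Real.rpow_mul hTnn, ← Real.rpow_mul hn1, ← Real.rpow_mul hn2,
    Real.mul_rpow (Real.rpow_nonneg hn1 _) (Real.rpow_nonneg hn2 _), ← Real.rpow_mul hn1,
    ← Real.rpow_mul hn2] at h7
  have hne : u - l ≠ 0 := by linarith
  have e1 : (1 + s) / 2 * 2 = 1 + s := by ring
  have e2 : 1 / 2 * (1 - (s - l) / (u - l)) * 2 = (u - s) / (u - l) := by
    field_simp
    ring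
  have e3 : 1 / 2 * ((s - l) / (u - l)) * 2 = (s - l) / (u - l) := by ring
  rw [e1, e2, e3] at h7
  exact h7

end Interpolation

/-! ### Matrix powers, supports, and the norm for singular weights -/

section RenyiNorm

variable {m n : Type*} [Fintype m] [DecidableEq m] [Fintype n] [DecidableEq n]

lemma mpow_posSemidef {X : Matrix n n ℂ} (hX : X.PosSemidef) (p : ℝ) : (mpow X p).PosSemidef := by
  obtain ⟨U, d, hU, rfl, hd⟩ := exists_eq_conjDiag_of_posSemidef hX
  rw [mpow_conjDiag hU]
  exact conjDiag_posSemidef U fun i => Real.rpow_nonneg (hd i) p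

lemma mpow_mpow {X : Matrix n n ℂ} (hX : X.PosSemidef) (p q : ℝ) :
    mpow (mpow X p) q = mpow X (p * q) := by
  obtain ⟨U, d, hU, rfl, hd⟩ := exists_eq_conjDiag_of_posSemidef hX
  rw [mpow_conjDiag hU, mpow_conjDiag hU, mpow_conjDiag hU]
  congr 1
  ext i
  exact (Real.rpow_mul (hd i) p q).symm

lemma mpow_one {X : Matrix n n ℂ} (hX : X.PosSemidef) : mpow X 1 = X := by
  obtain ⟨U, d, hU, rfl, hd⟩ := exists_eq_conjDiag_of_posSemidef hX
  rw [mpow_conjDiag hU]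
  simp

/-- Because 0 ^ 0 = 1, a zero eigenvalue breaks the law of exponents when p + q = 0 and p ≠ 0. -/
lemma mpow_mul_mpow {X : Matrix n n ℂ} (hX : X.PosSemidef) {p q : ℝ} (h : p + q ≠ 0) :
    mpow X p * mpow X q = mpow X (p + q) := by
  obtain ⟨U, d, hU, rfl, hd⟩ := exists_eq_conjDiag_of_posSemidef hX
  rw [mpow_conjDiag hU, mpow_conjDiag hU, mpow_conjDiag hU, conjDiag_mul_conjDiag hU]
  congr 1
  ext i
  exact (Real.rpow_add' (hd i) h).symm

lemma kronecker_unitary {U : Matrix m m ℂ} {V : Matrix n n ℂ} (hU : Uᴴ * U = 1)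
    (hV : Vᴴ * V = 1) : (U ⊗ₖ V)ᴴ * (U ⊗ₖ V) = 1 := by
  rw [conjTranspose_kronecker, ← mul_kronecker_mul, hU, hV, one_kronecker_one]

lemma conjDiag_kronecker (U : Matrix m m ℂ) (V : Matrix n n ℂ) (d : m → ℝ) (e : n → ℝ) :
    conjDiag U d ⊗ₖ conjDiag V e = conjDiag (U ⊗ₖ V) (fun i => d i.1 * e i.2) := by
  rw [conjDiag, conjDiag, conjDiag, conjTranspose_kronecker, mul_kronecker_mul, mul_kronecker_mul,
    diagonal_kronecker_diagonal]
  simp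

lemma mpow_kronecker {X : Matrix m m ℂ} {Y : Matrix n n ℂ} (hX : X.PosSemidef)
    (hY : Y.PosSemidef) (p : ℝ) : mpow (X ⊗ₖ Y) p = mpow X p ⊗ₖ mpow Y p := by
  obtain ⟨U, d, hU, rfl, hd⟩ := exists_eq_conjDiag_of_posSemidef hX
  obtain ⟨V, e, hV, rfl, he⟩ := exists_eq_conjDiag_of_posSemidef hY
  rw [conjDiag_kronecker, mpow_conjDiag (kronecker_unitary hU hV), mpow_conjDiag hU,
    mpow_conjDiag hV, conjDiag_kronecker]
  congr 1
  ext i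
  exact Real.mul_rpow (hd i.1) (he i.2)

lemma conjDiag_transpose (U : Matrix n n ℂ) (d : n → ℝ) :
    (conjDiag U d)ᵀ = conjDiag (U.map star) d := by
  ext i j
  simp only [transpose_apply, conjDiag_apply, map_apply, star_star]
  exact Finset.sum_congr rfl fun k _ => by ring

lemma map_star_unitary {U : Matrix n n ℂ} (hU : Uᴴ * U = 1) :
    (U.map star)ᴴ * U.map star = 1 := by
  have h := congrArg (fun M : Matrix n n ℂ => M.map star) hU
  ext i j
  have h2 := congrFun (congrFun h i) j
  simp only [map_apply, mul_apply, star_sum, star_mul', conjTranspose_apply, star_star] at h2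
  simp only [mul_apply, conjTranspose_apply, map_apply, star_star]
  rw [h2]
  by_cases hij : i = j
  · subst hij
    simp
  · simp [one_apply_ne hij]

lemma mpow_transpose {X : Matrix n n ℂ} (hX : X.PosSemidef) (p : ℝ) :
    mpow Xᵀ p = (mpow X p)ᵀ := by
  obtain ⟨U, d, hU, rfl, hd⟩ := exists_eq_conjDiag_of_posSemidef hX
  rw [conjDiag_transpose, mpow_conjDiag (map_star_unitary hU), mpow_conjDiag hU,
    conjDiag_transpose]

lemma supp_le_iff {X Y : Matrix n n ℂ} :
    supp X ≤ supp Y ↔ ∀ x : n → ℂ, ∃ y : n → ℂ, Y *ᵥ y = X *ᵥ x := by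
  constructor
  · intro h x
    obtain ⟨y, hy⟩ := h ⟨WithLp.toLp 2 x, rfl⟩
    refine ⟨y.ofLp, ?_⟩
    have := congrArg WithLp.ofLp hy
    simpa using this
  · rintro h _ ⟨x, rfl⟩
    obtain ⟨y, hy⟩ := h x.ofLp
    refine ⟨WithLp.toLp 2 y, ?_⟩
    apply (WithLp.ofLp_injective 2)
    simpa using hy

lemma supp_isOrtho_of_mul_eq_zero {X Y : Matrix n n ℂ} (hX : X.IsHermitian) (h : X * Y = 0) :
    supp X ⟂ supp Y := by
  rw [Submodule.isOrtho_iff_inner_eq]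
  rintro _ ⟨x, rfl⟩ _ ⟨y, rfl⟩
  rw [EuclideanSpace.inner_eq_star_dotProduct, dotProduct_comm]
  simp only [toLpLin_apply]
  rw [star_mulVec, ← dotProduct_mulVec, mulVec_mulVec, hX.eq, h]
  simp

lemma supp_eq_bot_iff {X : Matrix n n ℂ} : supp X = ⊥ ↔ X = 0 := by
  rw [supp, LinearMap.range_eq_bot]
  exact LinearEquiv.map_eq_zero_iff _

lemma eq_zero_of_supp_isOrtho_of_le {X Y : Matrix n n ℂ} (h : supp X ≤ supp Y)
    (ho : supp X ⟂ supp Y) : X = 0 :=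
  supp_eq_bot_iff.mp (Submodule.isOrtho_self.mp (ho.mono_right h))

lemma row_eq_zero_of_diag_eq_zero {M : Matrix m n ℂ} {i : m} (h : (M * Mᴴ) i i = 0) (j : n) :
    M i j = 0 := by
  rw [mul_apply] at h
  have h2 : ((∑ j, ‖M i j‖ ^ 2 : ℝ) : ℂ) = ((0 : ℝ) : ℂ) := by
    rw [Complex.ofReal_zero, ← h]
    push_cast
    refine Finset.sum_congr rfl fun j _ => ?_
    rw [conjTranspose_apply, RCLike.star_def, Complex.mul_conj']
  have h3 : ∑ j, ‖M i j‖ ^ 2 = 0 := by exact_mod_cast h2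
  rw [Finset.sum_eq_zero_iff_of_nonneg (fun i _ => by positivity)] at h3
  simpa using h3 j (Finset.mem_univ j)

/-- The support of `R Rᴴ` lies in that of `U diag(d) Uᴴ` iff the rows of `Uᴴ R` at the zeros of `d`
vanish. -/
lemma supp_le_supp_conjDiag_iff {R : Matrix m n ℂ} {U : Matrix m m ℂ} (hU : Uᴴ * U = 1)
    {d : m → ℝ} : supp (R * Rᴴ) ≤ supp (conjDiag U d) ↔ ∀ i, d i = 0 → ∀ j, (Uᴴ * R) i j = 0 := by
  rw [supp_le_iff]
  constructor
  · intro h i hi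
    apply row_eq_zero_of_diag_eq_zero
    have h1 : ∀ x : m → ℂ, ((Uᴴ * (R * Rᴴ)) *ᵥ x) i = 0 := by
      intro x
      obtain ⟨y, hy⟩ := h x
      rw [← mulVec_mulVec, ← hy, conjDiag, mulVec_mulVec, Matrix.mul_assoc, ← Matrix.mul_assoc,
        hU, Matrix.one_mul, ← mulVec_mulVec, mulVec_diagonal, hi]
      simp
    have h2 := h1 (fun k => U k i)
    have h3 : (Uᴴ * R * (Uᴴ * R)ᴴ) i i = ((Uᴴ * (R * Rᴴ)) *ᵥ fun k => U k i) i := by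
      rw [conjTranspose_mul, conjTranspose_conjTranspose, Matrix.mul_assoc, ← Matrix.mul_assoc R,
        ← Matrix.mul_assoc]
      rfl
    rw [h3, h2]
  · intro h x
    refine ⟨(conjDiag U (fun i => (d i)⁻¹)) *ᵥ ((R * Rᴴ) *ᵥ x), ?_⟩
    have h1 : conjDiag U d * conjDiag U (fun i => (d i)⁻¹) * R = R := by
      rw [conjDiag_mul_conjDiag hU, conjDiag, Matrix.mul_assoc]
      have h2 : diagonal (fun i => ((d i * (d i)⁻¹ : ℝ) : ℂ)) * (Uᴴ * R) = Uᴴ * R := by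
        ext i j
        rw [diagonal_mul]
        by_cases hi : d i = 0
        · rw [h i hi j, mul_zero]
        · rw [mul_inv_cancel₀ hi]
          simp
      rw [Matrix.mul_assoc, h2, ← Matrix.mul_assoc, mul_eq_one_comm.mp hU, Matrix.one_mul]
    rw [mulVec_mulVec, mulVec_mulVec, ← Matrix.mul_assoc, h1]

/-- The quasi-norm `‖Rᴴ D ^ s R‖` of Schatten index `1 / (1 + s)`. -/
def renyiNorm (D : Matrix m m ℂ) (R : Matrix m n ℂ) (s : ℝ) : ℝ :=
  powTrace (1 / (1 + s)) (Rᴴ * mpow D s * R) ^ (1 + s)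

lemma renyi_posSemidef {D : Matrix m m ℂ} (hD : D.PosSemidef) (R : Matrix m n ℂ) (s : ℝ) :
    (Rᴴ * mpow D s * R).PosSemidef :=
  (mpow_posSemidef hD s).conjTranspose_mul_mul_same R

lemma renyiNorm_nonneg {D : Matrix m m ℂ} (hD : D.PosSemidef) (R : Matrix m n ℂ) (s : ℝ) :
    0 ≤ renyiNorm D R s :=
  Real.rpow_nonneg (powTrace_nonneg _ (renyi_posSemidef hD R s)) _

lemma trace_conjTranspose_mul_self_re (M : Matrix m n ℂ) :
    (Mᴴ * M).trace.re = ∑ j, ∑ i, ‖M i j‖ ^ 2 := by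
  rw [trace, Complex.re_sum]
  refine Finset.sum_congr rfl fun j _ => ?_
  rw [diag_apply, mul_apply, Complex.re_sum]
  refine Finset.sum_congr rfl fun i _ => ?_
  rw [conjTranspose_apply, RCLike.star_def, Complex.conj_mul', ← Complex.ofReal_pow,
    Complex.ofReal_re]

/-- Away from `s = 0` the function `renyiNorm D R` agrees with a logarithmically convex one whose
value at `0` is `‖R‖₂ ^ 2` when `D` supports `R Rᴴ`, and at most that in general. -/
lemma exists_logConvex_renyiNorm {D : Matrix m m ℂ} (hD : D.PosSemidef) (R : Matrix m n ℂ) :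
    ∃ N : ℝ → ℝ, (∀ s, 0 ≤ N s) ∧ (∀ s, s ≠ 0 → N s = renyiNorm D R s) ∧
      N 0 ≤ (Rᴴ * R).trace.re ∧ (supp (R * Rᴴ) ≤ supp D → N 0 = (Rᴴ * R).trace.re) ∧
      ∀ l s u : ℝ, -1 < l → l ≤ s → s ≤ u → u < 1 → l < u →
        N s ≤ N l ^ ((u - s) / (u - l)) * N u ^ ((s - l) / (u - l)) := by
  obtain ⟨U, d, hU, rfl, hd⟩ := exists_eq_conjDiag_of_posSemidef hD
  -- Zero eigenvalues become 1 and the matching rows of Uᴴ R become 0. For s ≠ 0 nothing changes,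
  -- since 0 ^ s = 0; at s = 0 this avoids 0 ^ 0 = 1 and projects onto the support of `D`.
  set d' : m → ℝ := fun i => if d i = 0 then 1 else d i
  set R' : Matrix m n ℂ := diagonal (fun i => if d i = 0 then (0 : ℂ) else 1) * (Uᴴ * R) with hR'
  have hd' : ∀ i, 0 < d' i := by
    intro i
    simp only [d']
    split_ifs with h
    · exact one_pos
    · exact lt_of_le_of_ne (hd i) (Ne.symm h)
  have hR'app : ∀ i j, R' i j = if d i = 0 then 0 else (Uᴴ * R) i j := by
    intro i j
    rw [hR', diagonal_mul]
    split_ifs <;> simp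
  have htr : (R'ᴴ * R').trace.re = weightedNorm d' R' 0 := by
    have h0 : R'ᴴ * diagonal (fun i => ((d' i ^ (0 : ℝ) : ℝ) : ℂ)) * R' = R'ᴴ * R' := by
      simp
    rw [weightedNorm, h0, add_zero, div_one, powTrace_one (posSemidef_conjTranspose_mul_self R'),
      Real.rpow_one]
  have hUR : (Rᴴ * R).trace.re = ∑ j, ∑ i, ‖(Uᴴ * R) i j‖ ^ 2 := by
    rw [← trace_conjTranspose_mul_self_re, conjTranspose_mul, conjTranspose_conjTranspose,
      Matrix.mul_assoc, ← Matrix.mul_assoc U, mul_eq_one_comm.mp hU, Matrix.one_mul]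
  refine ⟨weightedNorm d' R', weightedNorm_nonneg (fun i => (hd' i).le) R', ?_, ?_, ?_, ?_⟩
  · intro s hs
    rw [weightedNorm, renyiNorm, mpow_conjDiag hU]
    congr 2
    have h1 : Rᴴ * conjDiag U (fun i => d i ^ s) * R
        = (Uᴴ * R)ᴴ * diagonal (fun i => ((d i ^ s : ℝ) : ℂ)) * (Uᴴ * R) := by
      rw [conjTranspose_mul, conjTranspose_conjTranspose, conjDiag]
      simp only [Matrix.mul_assoc]
    rw [h1]
    ext j k
    rw [mul_apply, mul_apply]
    refine Finset.sum_congr rfl fun i _ => ?_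
    rw [mul_diagonal, mul_diagonal, conjTranspose_apply, conjTranspose_apply, hR'app, hR'app]
    simp only [d']
    split_ifs with h
    · rw [h, Real.zero_rpow hs]
      simp
    · rfl
  · rw [← htr, trace_conjTranspose_mul_self_re, hUR]
    refine Finset.sum_le_sum fun j _ => Finset.sum_le_sum fun i _ => ?_
    rw [hR'app]
    split_ifs
    · simp
    · rfl
  · intro h
    rw [supp_le_supp_conjDiag_iff hU] at h
    rw [← htr, trace_conjTranspose_mul_self_re, hUR]
    refine Finset.sum_congr rfl fun j _ => Finset.sum_congr rfl fun i _ => ?_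
    rw [hR'app]
    split_ifs with hi
    · rw [h i hi j]
    · rfl
  · intro l s u hl hls hsu hu hlu
    exact weightedNorm_interp hd' R' hl hls hsu hu hlu

/-! ### Marginals and the supports they dominate -/

variable {A B : Type*} [Fintype A] [DecidableEq A] [Fintype B] [DecidableEq B]

lemma margA_posSemidef {ρ : Matrix (A × B) (A × B) ℂ} (hρ : ρ.PosSemidef) :
    (margA ρ).PosSemidef := by
  have h : margA ρ = ∑ b, ρ.submatrix (fun a => (a, b)) (fun a => (a, b)) := by
    ext a a'
    simp [margA, Matrix.sum_apply]
  rw [h]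
  exact posSemidef_sum _ fun b _ => hρ.submatrix _

lemma margB_posSemidef {ρ : Matrix (A × B) (A × B) ℂ} (hρ : ρ.PosSemidef) :
    (margB ρ).PosSemidef := by
  have h : margB ρ = ∑ a, ρ.submatrix (fun b => (a, b)) (fun b => (a, b)) := by
    ext a a'
    simp [margB, Matrix.sum_apply]
  rw [h]
  exact posSemidef_sum _ fun b _ => hρ.submatrix _

lemma margA_kronecker_conj (ρ : Matrix (A × B) (A × B) ℂ) (V : Matrix A A ℂ) {W : Matrix B B ℂ}
    (hW : Wᴴ * W = 1) : margA ((V ⊗ₖ W) * ρ * (V ⊗ₖ W)ᴴ) = V * margA ρ * Vᴴ := by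
  have hW' : ∀ b b', ∑ k, W k b * star (W k b') = (1 : Matrix B B ℂ) b' b := by
    intro b b'
    rw [← hW, mul_apply]
    exact Finset.sum_congr rfl fun k _ => by rw [conjTranspose_apply, mul_comm]
  ext i j
  simp only [margA, mul_apply, conjTranspose_apply, kronecker_apply, Fintype.sum_prod_type,
    Finset.sum_mul, star_mul']
  calc ∑ k, ∑ a', ∑ b', ∑ a, ∑ b, V i a * W k b * ρ (a, b) (a', b') * (star (V j a') * star (W k b'))
      = ∑ a', ∑ b', ∑ a, ∑ b, V i a * ρ (a, b) (a', b') * star (V j a') *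
        ∑ k, W k b * star (W k b') := by
        rw [Finset.sum_comm]
        refine Finset.sum_congr rfl fun a' _ => ?_
        rw [Finset.sum_comm]
        refine Finset.sum_congr rfl fun b' _ => ?_
        rw [Finset.sum_comm]
        refine Finset.sum_congr rfl fun a _ => ?_
        rw [Finset.sum_comm]
        refine Finset.sum_congr rfl fun b _ => ?_
        rw [Finset.mul_sum]
        exact Finset.sum_congr rfl fun k _ => by ring
    _ = ∑ a', ∑ a, V i a * (∑ b, ρ (a, b) (a', b)) * star (V j a') := by
        refine Finset.sum_congr rfl fun a' _ => ?_
        rw [Finset.sum_comm]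
        refine Finset.sum_congr rfl fun a _ => ?_
        rw [Finset.mul_sum, Finset.sum_mul]
        refine Finset.sum_congr rfl fun b' _ => ?_
        simp only [hW', one_apply]
        simp
    _ = _ := by simp only [Finset.mul_sum, Finset.sum_mul]

lemma margB_kronecker_conj (ρ : Matrix (A × B) (A × B) ℂ) {V : Matrix A A ℂ} (W : Matrix B B ℂ)
    (hV : Vᴴ * V = 1) : margB ((V ⊗ₖ W) * ρ * (V ⊗ₖ W)ᴴ) = W * margB ρ * Wᴴ := by
  have h := margA_kronecker_conj (ρ.submatrix Prod.swap Prod.swap) W hV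
  have h1 : ∀ τ : Matrix (A × B) (A × B) ℂ, margA (τ.submatrix Prod.swap Prod.swap) = margB τ := by
    intro τ
    rfl
  rw [h1] at h
  rw [← h, ← h1]
  congr 1
  have hVW : W ⊗ₖ V = (V ⊗ₖ W).submatrix Prod.swap Prod.swap := by
    ext i j
    simp [mul_comm]
  rw [hVW, conjTranspose_submatrix, ← Equiv.coe_prodComm, submatrix_mul_equiv, submatrix_mul_equiv]

/-- In a product basis diagonalizing the marginal, a zero eigenvalue is a sum of nonnegative
diagonal entries of ρ. Each of them vanishes, and with ρ = R Rᴴ so does the corresponding row of the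
rotated `R`. -/
lemma row_eq_zero_of_margA_eq {ρ R : Matrix (A × B) (A × B) ℂ} (hρ : ρ = R * Rᴴ) {U : Matrix A A ℂ}
    {V : Matrix B B ℂ} (hU : Uᴴ * U = 1) (hV : Vᴴ * V = 1) {a : A → ℝ}
    (ha : margA ρ = conjDiag U a) {i : A} (hi : a i = 0) (j : B) (k : A × B) :
    ((U ⊗ₖ V)ᴴ * R) (i, j) k = 0 := by
  apply row_eq_zero_of_diag_eq_zero
  have hV' : (Vᴴ)ᴴ * Vᴴ = 1 := by simpa using mul_eq_one_comm.mp hV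
  have h := margA_kronecker_conj ρ Uᴴ hV'
  rw [ha, mul_conjDiag_mul, hU] at h
  have h2 := congrFun (congrFun h i) i
  have h3 : conjDiag (1 : Matrix A A ℂ) a i i = 0 := by simp [conjDiag, hi]
  rw [h3, margA] at h2
  have hM : (U ⊗ₖ V)ᴴ * R * ((U ⊗ₖ V)ᴴ * R)ᴴ = (Uᴴ ⊗ₖ Vᴴ) * ρ * (Uᴴ ⊗ₖ Vᴴ)ᴴ := by
    rw [conjTranspose_mul, hρ, ← conjTranspose_kronecker]
    simp only [Matrix.mul_assoc]
  rw [hM]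
  have hpsd : ((Uᴴ ⊗ₖ Vᴴ) * ρ * (Uᴴ ⊗ₖ Vᴴ)ᴴ).PosSemidef := by
    rw [hρ]
    exact (posSemidef_self_mul_conjTranspose R).mul_mul_conjTranspose_same _
  rw [Finset.sum_eq_zero_iff_of_nonneg fun b _ => hpsd.diag_nonneg] at h2
  exact h2 j (Finset.mem_univ j)

lemma row_eq_zero_of_margB_eq {ρ R : Matrix (A × B) (A × B) ℂ} (hρ : ρ = R * Rᴴ) {U : Matrix A A ℂ}
    {V : Matrix B B ℂ} (hU : Uᴴ * U = 1) (hV : Vᴴ * V = 1) {b : B → ℝ}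
    (hb : margB ρ = conjDiag V b) {j : B} (hj : b j = 0) (i : A) (k : A × B) :
    ((U ⊗ₖ V)ᴴ * R) (i, j) k = 0 := by
  apply row_eq_zero_of_diag_eq_zero
  have hU' : (Uᴴ)ᴴ * Uᴴ = 1 := by simpa using mul_eq_one_comm.mp hU
  have h := margB_kronecker_conj ρ Vᴴ hU'
  rw [hb, mul_conjDiag_mul, hV] at h
  have h2 := congrFun (congrFun h j) j
  have h3 : conjDiag (1 : Matrix B B ℂ) b j j = 0 := by simp [conjDiag, hj]
  rw [h3, margB] at h2
  have hM : (U ⊗ₖ V)ᴴ * R * ((U ⊗ₖ V)ᴴ * R)ᴴ = (Uᴴ ⊗ₖ Vᴴ) * ρ * (Uᴴ ⊗ₖ Vᴴ)ᴴ := by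
    rw [conjTranspose_mul, hρ, ← conjTranspose_kronecker]
    simp only [Matrix.mul_assoc]
  rw [hM]
  have hpsd : ((Uᴴ ⊗ₖ Vᴴ) * ρ * (Uᴴ ⊗ₖ Vᴴ)ᴴ).PosSemidef := by
    rw [hρ]
    exact (posSemidef_self_mul_conjTranspose R).mul_mul_conjTranspose_same _
  rw [Finset.sum_eq_zero_iff_of_nonneg fun b _ => hpsd.diag_nonneg] at h2
  exact h2 i (Finset.mem_univ i)

lemma exists_sqrt {ρ : Matrix n n ℂ} (hρ : ρ.PosSemidef) :
    ∃ R : Matrix n n ℂ, Rᴴ = R ∧ R * R = ρ := by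
  refine ⟨mpow ρ (1 / 2), (mpow_posSemidef hρ _).1, ?_⟩
  rw [mpow_mul_mpow hρ (by norm_num)]
  norm_num
  exact mpow_one hρ

/-- This gives finiteness at α = 1. -/
lemma supp_le_supp_marginals {ρ : Matrix (A × B) (A × B) ℂ} (hρ : ρ.PosSemidef) :
    supp ρ ≤ supp (margA ρ ⊗ₖ margB ρ) := by
  obtain ⟨R, hR, hRR⟩ := exists_sqrt hρ
  obtain ⟨U, a, hU, ha, -⟩ := exists_eq_conjDiag_of_posSemidef (margA_posSemidef hρ)
  obtain ⟨V, b, hV, hb, -⟩ := exists_eq_conjDiag_of_posSemidef (margB_posSemidef hρ)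
  have hρR : ρ = R * Rᴴ := by rw [hR, hRR]
  conv_lhs => rw [hρR]
  rw [ha, hb, conjDiag_kronecker, supp_le_supp_conjDiag_iff (kronecker_unitary hU hV)]
  rintro ⟨i, j⟩ hij k
  rcases mul_eq_zero.mp hij with h | h
  · exact row_eq_zero_of_margA_eq hρR hU hV ha h j k
  · exact row_eq_zero_of_margB_eq hρR hU hV hb h i k

/-- Invertible states of `B` are always feasible, in particular those produced by the minimax step.
-/
lemma supp_le_supp_marginal_kronecker {ρ : Matrix (A × B) (A × B) ℂ} (hρ : ρ.PosSemidef)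
    {V : Matrix B B ℂ} (hV : Vᴴ * V = 1) {b : B → ℝ} (hb : ∀ j, 0 < b j) :
    supp ρ ≤ supp (margA ρ ⊗ₖ conjDiag V b) := by
  obtain ⟨R, hR, hRR⟩ := exists_sqrt hρ
  obtain ⟨U, a, hU, ha, -⟩ := exists_eq_conjDiag_of_posSemidef (margA_posSemidef hρ)
  have hρR : ρ = R * Rᴴ := by rw [hR, hRR]
  conv_lhs => rw [hρR]
  rw [ha, conjDiag_kronecker, supp_le_supp_conjDiag_iff (kronecker_unitary hU hV)]
  rintro ⟨i, j⟩ hij k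
  rcases mul_eq_zero.mp hij with h | h
  · exact row_eq_zero_of_margA_eq hρR hU hV ha h j k
  · exact absurd h (hb j).ne'

end RenyiNorm

/-! ### Convex trace balls -/

section TraceBall

variable {m n : Type*} [Fintype m] [DecidableEq m] [Fintype n] [DecidableEq n]

lemma conjDiag_diag_re (U : Matrix m n ℂ) (d : n → ℝ) (i : m) :
    (conjDiag U d i i).re = ∑ k, ‖U i k‖ ^ 2 * d k := by
  rw [conjDiag_apply, Complex.re_sum]
  refine Finset.sum_congr rfl fun k _ => ?_
  have : U i k * (d k : ℂ) * star (U i k) = ((‖U i k‖ ^ 2 * d k : ℝ) : ℂ) := by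
    push_cast
    rw [← Complex.mul_conj', RCLike.star_def]
    ring
  rw [this, Complex.ofReal_re]

/-- The matrices whose diagonal in every orthonormal basis satisfies `∑ f ≤ 1`. For convex `f` and
Hermitian matrices this says `tr f(Y) ≤ 1`. -/
def traceBall (f : ℝ → ℝ) : Set (Matrix n n ℂ) :=
  {Y | ∀ U : Matrix n n ℂ, Uᴴ * U = 1 → ∑ i, f (((Uᴴ * Y * U) i i).re) ≤ 1}

/-- **Peierls' inequality**. -/
lemma conjDiag_mem_traceBall {s : Set ℝ} {f : ℝ → ℝ} (hf : ConvexOn ℝ s f) {C : Matrix n n ℂ}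
    (hC : Cᴴ * C = 1) {x : n → ℝ} (hx : ∀ i, x i ∈ s) (h1 : ∑ i, f (x i) ≤ 1) :
    conjDiag C x ∈ traceBall f := by
  intro U hU
  have hU' : (Uᴴ)ᴴ * Uᴴ = 1 := by simpa using mul_eq_one_comm.mp hU
  have hUC := unitary_mul hU' hC
  refine le_trans ?_ h1
  have h2 : Uᴴ * conjDiag C x * U = conjDiag (Uᴴ * C) x := by
    rw [← mul_conjDiag_mul, conjTranspose_conjTranspose]
  calc ∑ i, f (((Uᴴ * conjDiag C x * U) i i).re)
      ≤ ∑ i, ∑ k, ‖(Uᴴ * C) i k‖ ^ 2 * f (x k) := by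
        refine Finset.sum_le_sum fun i _ => ?_
        rw [h2, conjDiag_diag_re]
        exact hf.map_sum_le (fun k _ => by positivity) (sum_norm_sq_row hUC i) fun k _ => hx k
    _ = ∑ k, f (x k) := by
        rw [Finset.sum_comm]
        refine Finset.sum_congr rfl fun k _ => ?_
        rw [← Finset.sum_mul, sum_norm_sq_col hUC, one_mul]

lemma sum_le_one_of_mem_traceBall {f : ℝ → ℝ} {C : Matrix n n ℂ} (hC : Cᴴ * C = 1) {x : n → ℝ}
    (h : conjDiag C x ∈ traceBall f) : ∑ i, f (x i) ≤ 1 := by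
  have h1 := h C hC
  have h2 : Cᴴ * conjDiag C x * C = conjDiag (Cᴴ * C) x := by
    rw [← mul_conjDiag_mul, conjTranspose_conjTranspose]
  rw [h2, hC] at h1
  refine le_trans (le_of_eq ?_) h1
  refine Finset.sum_congr rfl fun i _ => ?_
  simp [conjDiag]

/-- The constraint in each fixed basis is convex because the scalar `f` is; quantifying over all
bases thus makes convexity of Y ↦ tr f(Y) unnecessary. -/
lemma convex_inter_traceBall {s : Set ℝ} {f : ℝ → ℝ} (hf : ConvexOn ℝ s f)
    {S : Set (Matrix n n ℂ)} (hS : Convex ℝ S)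
    (hd : ∀ Y ∈ S, ∀ U : Matrix n n ℂ, Uᴴ * U = 1 → ∀ i, ((Uᴴ * Y * U) i i).re ∈ s) :
    Convex ℝ (S ∩ traceBall f) := by
  rintro Y ⟨hY, hY1⟩ Z ⟨hZ, hZ1⟩ a b ha hb hab
  refine ⟨hS hY hZ ha hb hab, fun U hU => ?_⟩
  have hlin : ∀ i, ((Uᴴ * (a • Y + b • Z) * U) i i).re
      = a • ((Uᴴ * Y * U) i i).re + b • ((Uᴴ * Z * U) i i).re := by
    intro i
    simp [Matrix.mul_add, Matrix.add_mul]
  calc ∑ i, f (((Uᴴ * (a • Y + b • Z) * U) i i).re)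
      ≤ ∑ i, (a * f (((Uᴴ * Y * U) i i).re) + b * f (((Uᴴ * Z * U) i i).re)) :=
        Finset.sum_le_sum fun i _ => by
          rw [hlin]
          exact hf.2 (hd Y hY U hU i) (hd Z hZ U hU i) ha hb hab
    _ = a * ∑ i, f (((Uᴴ * Y * U) i i).re) + b * ∑ i, f (((Uᴴ * Z * U) i i).re) := by
        rw [Finset.sum_add_distrib, Finset.mul_sum, Finset.mul_sum]
    _ ≤ a * 1 + b * 1 := by
        gcongr
        · exact hY1 U hU
        · exact hZ1 U hU
    _ = 1 := by linarith

lemma posSemidef_real_smul {Y : Matrix n n ℂ} (hY : Y.PosSemidef) {a : ℝ} (ha : 0 ≤ a) :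
    (a • Y).PosSemidef := by
  have h : a • Y = (a : ℂ) • Y := by
    ext i j
    simp
  rw [h]
  exact hY.smul (by exact_mod_cast ha)

lemma posDef_real_smul {Y : Matrix n n ℂ} (hY : Y.PosDef) {a : ℝ} (ha : 0 < a) :
    (a • Y).PosDef := by
  have h : a • Y = (a : ℂ) • Y := by
    ext i j
    simp
  rw [h]
  exact hY.smul (by exact_mod_cast ha)

lemma convex_posSemidef : Convex ℝ {Y : Matrix n n ℂ | Y.PosSemidef} :=
  fun _ hY _ hZ _ _ ha hb _ => (posSemidef_real_smul hY ha).add (posSemidef_real_smul hZ hb)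

lemma convex_posDef : Convex ℝ {Y : Matrix n n ℂ | Y.PosDef} := by
  intro Y hY Z hZ a b ha hb hab
  rcases ha.eq_or_lt with rfl | ha'
  · have : b = 1 := by linarith
    subst this
    simpa using hZ
  · exact (posDef_real_smul hY ha').add_posSemidef (posSemidef_real_smul hZ.posSemidef hb)

lemma posSemidef_conj_diag_re {Y : Matrix n n ℂ} (hY : Y.PosSemidef) (U : Matrix n n ℂ) (i : n) :
    0 ≤ ((Uᴴ * Y * U) i i).re :=
  (Complex.le_def.mp (hY.conjTranspose_mul_mul_same U).diag_nonneg).1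

lemma posDef_conj_diag_re {Y : Matrix n n ℂ} (hY : Y.PosDef) {U : Matrix n n ℂ}
    (hU : Uᴴ * U = 1) (i : n) : 0 < ((Uᴴ * Y * U) i i).re := by
  have hinj : Function.Injective U.mulVec := by
    intro x y hxy
    have := congrArg (fun v => Uᴴ *ᵥ v) hxy
    simpa [mulVec_mulVec, hU] using this
  exact (Complex.lt_def.mp (hY.conjTranspose_mul_mul_same hinj).diag_pos).1

lemma norm_apply_le_of_posSemidef {Y : Matrix n n ℂ} (hY : Y.PosSemidef) (i j : n) :
    ‖Y i j‖ ≤ ((Y i i).re + (Y j j).re) / 2 := by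
  obtain ⟨R, hR, rfl⟩ := exists_sqrt hY
  have hdiag : ∀ i, ((R * R) i i).re = ∑ k, ‖R i k‖ ^ 2 := by
    intro i
    nth_rewrite 2 [← hR]
    rw [mul_apply, Complex.re_sum]
    refine Finset.sum_congr rfl fun k _ => ?_
    rw [conjTranspose_apply, RCLike.star_def, Complex.mul_conj', ← Complex.ofReal_pow,
      Complex.ofReal_re]
  rw [hdiag, hdiag, ← Finset.sum_add_distrib, Finset.sum_div]
  nth_rewrite 2 [← hR]
  rw [mul_apply]
  refine (norm_sum_le _ _).trans (Finset.sum_le_sum fun k _ => ?_)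
  rw [conjTranspose_apply, norm_mul, norm_star]
  linarith [two_mul_le_add_sq ‖R i k‖ ‖R j k‖]

lemma isClosed_posSemidef : IsClosed {Y : Matrix n n ℂ | Y.PosSemidef} := by
  have h : {Y : Matrix n n ℂ | Y.PosSemidef}
      = {Y | Yᴴ = Y} ∩ ⋂ x : n → ℂ, {Y | 0 ≤ star x ⬝ᵥ (Y *ᵥ x)} := by
    ext Y
    simp only [Set.mem_ofPred_eq, Set.mem_inter_iff, Set.mem_iInter,
      posSemidef_iff_dotProduct_mulVec, IsHermitian]
  rw [h]
  refine IsClosed.inter (isClosed_eq (by fun_prop) continuous_id) (isClosed_iInter fun x => ?_)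
  exact isClosed_le continuous_const (by fun_prop)

/-- Each basis gives a closed condition. The standard basis alone bounds the diagonal by 1, and
positivity bounds the other entries by the diagonal. -/
lemma isCompact_posSemidef_inter_traceBall_rpow {p : ℝ} (hp : 1 ≤ p) :
    IsCompact ({Y : Matrix n n ℂ | Y.PosSemidef} ∩ traceBall fun x => x ^ p) := by
  have hball : IsClosed (traceBall (n := n) fun x => x ^ p) := by
    have h : traceBall (n := n) (fun x => x ^ p) = ⋂ U : Matrix n n ℂ, ⋂ _ : Uᴴ * U = 1,
        {Y | ∑ i, ((Uᴴ * Y * U) i i).re ^ p ≤ 1} := by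
      ext Y
      simp [traceBall]
    rw [h]
    refine isClosed_iInter fun U => isClosed_iInter fun _ => isClosed_le ?_ continuous_const
    refine continuous_finsetSum _ fun i _ => ?_
    refine Continuous.rpow_const ?_ fun _ => Or.inr (by linarith)
    refine Complex.continuous_re.comp ?_
    fun_prop
  have hentry : ∀ Y : Matrix n n ℂ, Y.PosSemidef → Y ∈ traceBall (fun x : ℝ => x ^ p) →
      ∀ i j, ‖Y i j‖ ≤ 1 := by
    intro Y hY hY1 i j
    have hdiag : ∀ i, (Y i i).re ≤ 1 := by
      intro i
      have h1 : ∑ i, (Y i i).re ^ p ≤ 1 := by simpa using hY1 1 (by simp)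
      have h0 : ∀ i, 0 ≤ (Y i i).re := fun i => (Complex.le_def.mp hY.diag_nonneg).1
      have h2 : (Y i i).re ^ p ≤ 1 := le_trans
        (Finset.single_le_sum (f := fun i => (Y i i).re ^ p)
          (fun k _ => Real.rpow_nonneg (h0 k) p) (Finset.mem_univ i)) h1
      by_contra hlt
      exact absurd h2 (not_le.mpr (Real.one_lt_rpow (not_le.mp hlt) (by linarith)))
    linarith [norm_apply_le_of_posSemidef hY i j, hdiag i, hdiag j]
  have hcpt : IsCompact (Set.univ.pi fun _ : n => Set.univ.pi fun _ : n =>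
      Metric.closedBall (0 : ℂ) 1) :=
    isCompact_univ_pi fun _ => isCompact_univ_pi fun _ => isCompact_closedBall _ _
  refine hcpt.of_isClosed_subset (isClosed_posSemidef.inter hball) ?_
  rintro Y ⟨hY, hY1⟩ i - j -
  rw [mem_closedBall_zero_iff]
  exact hentry Y hY hY1 i j

/-! ### Hölder and reverse Hölder inequalities for powers of states -/

/-- Hölder's inequality against the power of a subnormalized state. -/
lemma re_trace_mpow_mul_le {τ G : Matrix n n ℂ} (hτ : τ.PosSemidef) (hτ1 : τ.trace.re ≤ 1)
    (hG : G.PosSemidef) {t : ℝ} (ht : t ∈ Set.Ioo (0 : ℝ) 1) :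
    (mpow τ t * G).trace.re ≤ powTrace (1 / (1 - t)) G ^ (1 - t) := by
  obtain ⟨ht0, ht1⟩ := ht
  obtain ⟨U, d, hU, rfl, hd⟩ := exists_eq_conjDiag_of_posSemidef hτ
  obtain ⟨C, γ, hC, rfl, hγ⟩ := exists_eq_conjDiag_of_posSemidef hG
  rw [trace_conjDiag hU, Complex.ofReal_re] at hτ1
  rw [mpow_conjDiag hU, re_trace_conjDiag_mul_conjDiag, powTrace_conjDiag hC]
  have hU' : (Uᴴ)ᴴ * Uᴴ = 1 := by simpa using mul_eq_one_comm.mp hU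
  have hUC := unitary_mul hU' hC
  have h := sum_substochastic_rpow_mul_rpow_le (S := fun i j => ‖(Uᴴ * C) i j‖ ^ 2)
    (fun i j => by positivity) (fun i => (sum_norm_sq_row hUC i).le)
    (fun j => (sum_norm_sq_col hUC j).le) hd (y := fun j => γ j ^ (1 / (1 - t)))
    (fun j => Real.rpow_nonneg (hγ j) _) ht0 ht1
  have hy : ∀ j, (γ j ^ (1 / (1 - t))) ^ (1 - t) = γ j := by
    intro j
    rw [← Real.rpow_mul (hγ j), one_div_mul_cancel (by linarith), Real.rpow_one]
  simp only [hy] at h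
  refine h.trans (mul_le_of_le_one_left ?_ ?_)
  · exact Real.rpow_nonneg (Finset.sum_nonneg fun j _ => Real.rpow_nonneg (hγ j) _) _
  · exact Real.rpow_le_one (Finset.sum_nonneg fun i _ => hd i) hτ1 ht0.le

/-- Reverse Hölder inequality against a negative power of a subnormalized state. -/
lemma powTrace_rpow_le_re_trace_mpow_neg_mul {U V : Matrix n n ℂ} (hU : Uᴴ * U = 1)
    (hV : Vᴴ * V = 1) {d w : n → ℝ} (hd : ∀ i, 0 ≤ d i) (hd1 : ∑ i, d i ≤ 1) (hw : ∀ i, 0 ≤ w i)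
    (hsupp : ∀ i, d i = 0 → ∀ j, w j ≠ 0 → (Uᴴ * V) i j = 0) {t : ℝ} (ht : 0 < t) :
    powTrace (1 / (1 + t)) (conjDiag V w) ^ (1 + t)
      ≤ (mpow (conjDiag U d) (-t) * conjDiag V w).trace.re := by
  rw [mpow_conjDiag hU, re_trace_conjDiag_mul_conjDiag, powTrace_conjDiag hV]
  have hU' : (Uᴴ)ᴴ * Uᴴ = 1 := by simpa using mul_eq_one_comm.mp hU
  have hUV := unitary_mul hU' hV
  set p := 1 / (1 + t) with hp
  have hp0 : 0 < p := by positivity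
  have hp1 : p < 1 := by
    rw [hp, div_lt_one (by linarith)]
    linarith
  have hpt : p * (1 + t) = 1 := by
    rw [hp]
    field_simp
  set S : n → n → ℝ := fun i j => ‖(Uᴴ * V) i j‖ ^ 2 with hS
  have hSnn : ∀ i j, 0 ≤ S i j := fun i j => by positivity
  set T := ∑ i, ∑ j, S i j * d i ^ (-t) * w j with hT
  have hTnn : 0 ≤ T := Finset.sum_nonneg fun i _ => Finset.sum_nonneg fun j _ =>
    mul_nonneg (mul_nonneg (hSnn _ _) (Real.rpow_nonneg (hd i) _)) (hw j)
  -- The exponents p and 1 - p are chosen to cancel `d`: p (1 + t) = 1 gives d^(-tp) d^(1-p) = 1.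
  have h := sum_rpow_mul_rpow_le (Finset.univ : Finset (n × n))
    (F := fun q => S q.1 q.2 * d q.1 ^ (-t) * w q.2) (G := fun q => S q.1 q.2 * d q.1)
    (fun q _ => mul_nonneg (mul_nonneg (hSnn _ _) (Real.rpow_nonneg (hd _) _)) (hw _))
    (fun q _ => mul_nonneg (hSnn _ _) (hd _)) hp0 hp1
  rw [Fintype.sum_prod_type_right, Fintype.sum_prod_type, Fintype.sum_prod_type] at h
  have hG : ∑ i, ∑ j, S i j * d i ≤ 1 := by
    refine le_trans (le_of_eq ?_) hd1
    refine Finset.sum_congr rfl fun i _ => ?_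
    rw [← Finset.sum_mul, sum_norm_sq_row hUV, one_mul]
  have hGnn : 0 ≤ ∑ i, ∑ j, S i j * d i :=
    Finset.sum_nonneg fun i _ => Finset.sum_nonneg fun j _ => mul_nonneg (hSnn _ _) (hd _)
  have hterm : ∀ i j, (S i j * d i ^ (-t) * w j) ^ p * (S i j * d i) ^ (1 - p)
      = S i j * w j ^ p := by
    intro i j
    -- The convention 0 ^ (-t) = 0 kills the left side here; `hsupp` kills the right side.
    by_cases hi : d i = 0
    · rw [hi, Real.zero_rpow (by linarith), mul_zero, zero_mul, Real.zero_rpow hp0.ne', zero_mul]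
      by_cases hj : w j = 0
      · rw [hj, Real.zero_rpow hp0.ne', mul_zero]
      · simp only [hS]
        rw [hsupp i hi j hj]
        simp
    · have hi' : 0 < d i := lt_of_le_of_ne (hd i) (Ne.symm hi)
      rw [Real.mul_rpow (mul_nonneg (hSnn _ _) (Real.rpow_nonneg (hd i) _)) (hw j),
        Real.mul_rpow (hSnn _ _) (Real.rpow_nonneg (hd i) _), Real.mul_rpow (hSnn _ _) (hd i),
        ← Real.rpow_mul (hd i)]
      have h1 : S i j ^ p * S i j ^ (1 - p) = S i j := by
        rw [← Real.rpow_add_of_nonneg (hSnn _ _) hp0.le (by linarith)]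
        simp
      have h2 : d i ^ (-t * p) * d i ^ (1 - p) = 1 := by
        rw [← Real.rpow_add hi']
        have : -t * p + (1 - p) = 0 := by linarith
        rw [this, Real.rpow_zero]
      calc _ = (S i j ^ p * S i j ^ (1 - p)) * (d i ^ (-t * p) * d i ^ (1 - p)) * w j ^ p := by ring
        _ = _ := by rw [h1, h2, mul_one]
  have hl : ∑ j, ∑ i, (S i j * d i ^ (-t) * w j) ^ p * (S i j * d i) ^ (1 - p)
      = ∑ j, w j ^ p := by
    refine Finset.sum_congr rfl fun j _ => ?_
    simp only [hterm]
    rw [← Finset.sum_mul, sum_norm_sq_col hUV, one_mul]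
  rw [hl] at h
  have h3 : ∑ j, w j ^ p ≤ T ^ p := h.trans
    (mul_le_of_le_one_right (Real.rpow_nonneg hTnn _) (Real.rpow_le_one hGnn hG (by linarith)))
  have h4 := Real.rpow_le_rpow (Finset.sum_nonneg fun j _ => Real.rpow_nonneg (hw j) _) h3
    (z := 1 + t) (by linarith)
  rwa [← Real.rpow_mul hTnn, hpt, Real.rpow_one] at h4

/-! ### Reading a tripartite tensor along another cut -/

variable {A B C : Type*} [Fintype A] [DecidableEq A] [Fintype B] [DecidableEq B]
  [Fintype C] [DecidableEq C]

/-- The conjugate of the tensor `R` on `A ⊗ B ⊗ C` read as an operator from `B` to `A ⊗ C`. -/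
def reshape (R : Matrix (A × B) C ℂ) : Matrix (A × C) B ℂ :=
  fun p b => star (R (p.1, b) p.2)

lemma sum_reorder (T : C → C → A → B → A → B → ℂ) :
    ∑ c, ∑ c', ∑ a', ∑ b', ∑ a, ∑ b, T c c' a' b' a b
      = ∑ b, ∑ b', ∑ a, ∑ c', ∑ a', ∑ c, T c c' a' b' a b := by
  simp only [← Fintype.sum_prod_type']
  let e : (C × C × A × B × A × B) ≃ (B × B × A × C × A × C) :=
    ⟨fun x => (x.2.2.2.2.2, x.2.2.2.1, x.2.2.2.2.1, x.2.1, x.2.2.1, x.1),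
     fun y => (y.2.2.2.2.2, y.2.2.2.1, y.2.2.2.2.1, y.2.1, y.2.2.1, y.1),
     fun _ => rfl, fun _ => rfl⟩
  exact Fintype.sum_equiv e _ _ fun _ => rfl

/-- Both sides are the same contraction of `R`, its conjugate, `N`, `X` and `Y`, cut open along `C`
or along `B`. The conjugate in `reshape` puts the transpose on `N` rather than on `X` and `Y`. -/
lemma trace_mul_kronecker_eq (R : Matrix (A × B) C ℂ) (N : Matrix A A ℂ) (X : Matrix B B ℂ)
    (Y : Matrix C C ℂ) : (Y * (Rᴴ * (N ⊗ₖ X) * R)).trace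
      = (X * ((reshape R)ᴴ * (Nᵀ ⊗ₖ Y) * reshape R)).trace := by
  simp only [trace, diag_apply, mul_apply, kronecker_apply, Fintype.sum_prod_type, reshape,
    conjTranspose_apply, transpose_apply, star_star, Finset.mul_sum, Finset.sum_mul]
  rw [sum_reorder]
  iterate 6 refine Fintype.sum_congr _ _ fun _ => ?_
  ring

end TraceBall

/-! ### Duality and minimax -/

section Duality

variable {A B C : Type*} [Fintype A] [DecidableEq A] [Fintype B] [DecidableEq B]
  [Fintype C] [DecidableEq C]

/-- The dual quantity to `renyiNorm (M ⊗ₖ σ) R (-t)`. -/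
def dualNorm (M : Matrix A A ℂ) (R : Matrix (A × B) C ℂ) (τ : Matrix C C ℂ) (t : ℝ) : ℝ :=
  renyiNorm ((mpow M (-1))ᵀ ⊗ₖ τ) (reshape R) t

lemma dual_posSemidef {M : Matrix A A ℂ} (hM : M.PosSemidef) {τ : Matrix C C ℂ}
    (hτ : τ.PosSemidef) : ((mpow M (-1))ᵀ ⊗ₖ τ).PosSemidef :=
  (mpow_posSemidef hM _).transpose.kronecker hτ

lemma mpow_dual {M : Matrix A A ℂ} (hM : M.PosSemidef) {τ : Matrix C C ℂ} (hτ : τ.PosSemidef)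
    (t : ℝ) : mpow ((mpow M (-1))ᵀ ⊗ₖ τ) t = (mpow M (-t))ᵀ ⊗ₖ mpow τ t := by
  rw [mpow_kronecker (mpow_posSemidef hM _).transpose hτ, mpow_transpose (mpow_posSemidef hM _),
    mpow_mpow hM, neg_one_mul]

/-- Let W on `B` and G on `C` be the operators inside the two norms. Then ‖W‖ ≤ tr(σ^(-t) W) =
tr(τ^t G) ≤ ‖G‖, by reverse Hölder on `B`, the change of cut, and Hölder on `C`. -/
lemma dualNorm_le_renyiNorm {M : Matrix A A ℂ} (hM : M.PosSemidef) {σ : Matrix B B ℂ}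
    (hσ : σ.PosSemidef) (hσ1 : σ.trace.re ≤ 1) {τ : Matrix C C ℂ} (hτ : τ.PosSemidef)
    (hτ1 : τ.trace.re ≤ 1) {R : Matrix (A × B) C ℂ} {ρ : Matrix (A × B) (A × B) ℂ}
    (hρ : ρ = R * Rᴴ) (hsupp : supp ρ ≤ supp (M ⊗ₖ σ)) {t : ℝ} (ht : t ∈ Set.Ioo (0 : ℝ) 1) :
    dualNorm M R τ t ≤ renyiNorm (M ⊗ₖ σ) R (-t) := by
  obtain ⟨ht0, ht1⟩ := ht
  obtain ⟨U, a, hU, rfl, ha⟩ := exists_eq_conjDiag_of_posSemidef hM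
  obtain ⟨V, b, hV, rfl, hb⟩ := exists_eq_conjDiag_of_posSemidef hσ
  set K := reshape R with hK
  set W := Kᴴ * ((mpow (conjDiag U a) (-t))ᵀ ⊗ₖ mpow τ t) * K with hW
  have hWpsd : W.PosSemidef := PosSemidef.conjTranspose_mul_mul_same
    ((mpow_posSemidef hM _).transpose.kronecker (mpow_posSemidef hτ _)) K
  obtain ⟨E, w, hE, hWE, hw⟩ := exists_eq_conjDiag_of_posSemidef hWpsd
  rw [trace_conjDiag hV, Complex.ofReal_re] at hσ1
  -- Domination makes the rows of `R` vanish over the kernel of σ in a product eigenbasis; the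
  -- factor `U ⊗ₖ 1` rotates `A` back.
  have hrow : ∀ j, b j = 0 → ∀ k, (Vᴴ * Kᴴ) j k = 0 := by
    rintro j hj ⟨x, c⟩
    rw [conjDiag_kronecker, hρ, supp_le_supp_conjDiag_iff (kronecker_unitary hU hV)] at hsupp
    have h1 : (U ⊗ₖ (1 : Matrix B B ℂ)) * ((U ⊗ₖ V)ᴴ * R) = ((1 : Matrix A A ℂ) ⊗ₖ Vᴴ) * R := by
      rw [conjTranspose_kronecker, ← Matrix.mul_assoc, ← mul_kronecker_mul,
        mul_eq_one_comm.mp hU, Matrix.one_mul]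
    have h2 : ((U ⊗ₖ (1 : Matrix B B ℂ)) * ((U ⊗ₖ V)ᴴ * R)) (x, j) c = 0 := by
      rw [mul_apply, Fintype.sum_prod_type]
      refine Finset.sum_eq_zero fun i _ => Finset.sum_eq_zero fun j' _ => ?_
      rw [kronecker_apply]
      by_cases hjj : j = j'
      · subst hjj
        rw [hsupp (i, j) (by simp [hj]) c, mul_zero]
      · simp [one_apply_ne hjj]
    rw [h1, mul_apply, Fintype.sum_prod_type] at h2
    simp only [kronecker_apply] at h2
    rw [Finset.sum_eq_single x (fun i _ hi => by simp [one_apply_ne (Ne.symm hi)])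
      (fun h => absurd (Finset.mem_univ x) h)] at h2
    rw [mul_apply, ← h2]
    refine Finset.sum_congr rfl fun k _ => ?_
    simp [hK, reshape, conjTranspose_apply]
  -- An eigenvector of `W` with nonzero eigenvalue lies in the range of `W`, hence is orthogonal to
  -- the kernel of σ.
  have hVE : ∀ i, b i = 0 → ∀ j, w j ≠ 0 → (Vᴴ * E) i j = 0 := by
    intro i hi j hj
    have h1 : Vᴴ * W * E = Vᴴ * E * diagonal (fun i => (w i : ℂ)) := by
      rw [hWE, conjDiag]
      simp only [Matrix.mul_assoc, hE, Matrix.mul_one]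
    have h2 : (Vᴴ * W * E) i j = 0 := by
      have h3 : Vᴴ * W * E
          = (Vᴴ * Kᴴ) * (((mpow (conjDiag U a) (-t))ᵀ ⊗ₖ mpow τ t) * K * E) := by
        rw [hW]
        simp only [Matrix.mul_assoc]
      rw [h3, mul_apply]
      exact Finset.sum_eq_zero fun k _ => by rw [hrow i hi k, zero_mul]
    rw [h1, mul_diagonal] at h2
    exact (mul_eq_zero.mp h2).resolve_right (by exact_mod_cast hj)
  have h1 := powTrace_rpow_le_re_trace_mpow_neg_mul hV hE hb hσ1 hw hVE ht0
  have hG : (Rᴴ * mpow (conjDiag U a ⊗ₖ conjDiag V b) (-t) * R).PosSemidef :=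
    renyi_posSemidef (hM.kronecker hσ) R (-t)
  have h2 := re_trace_mpow_mul_le hτ hτ1 hG ⟨ht0, ht1⟩
  rw [mpow_kronecker hM hσ, trace_mul_kronecker_eq, ← hK, ← hW, hWE] at h2
  have h3 : dualNorm (conjDiag U a) R τ t = powTrace (1 / (1 + t)) (conjDiag E w) ^ (1 + t) := by
    rw [dualNorm, renyiNorm, mpow_dual hM hτ, ← hK, ← hW, hWE]
  have h4 : renyiNorm (conjDiag U a ⊗ₖ conjDiag V b) R (-t) = powTrace (1 / (1 - t))
      (Rᴴ * (mpow (conjDiag U a) (-t) ⊗ₖ mpow (conjDiag V b) (-t)) * R) ^ (1 - t) := by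
    rw [renyiNorm, mpow_kronecker hM hσ, ← sub_eq_add_neg]
  rw [h3, h4]
  exact h1.trans h2

/-- A bilinear minimax theorem, as a consequence of Sion's theorem. -/
lemma exists_forall_lt_of_forall_exists_lt {E F : Type*} [TopologicalSpace E] [AddCommGroup E]
    [Module ℝ E] [IsTopologicalAddGroup E] [ContinuousSMul ℝ E] [TopologicalSpace F]
    [AddCommGroup F] [Module ℝ F] [IsTopologicalAddGroup F] [ContinuousSMul ℝ F]
    (f : E →ₗ[ℝ] F →ₗ[ℝ] ℝ) (hf1 : ∀ y, Continuous fun x => f x y) (hf2 : ∀ x, Continuous (f x))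
    {X : Set E} {Y : Set F} (hX : IsCompact X) (hXne : X.Nonempty) (hXc : Convex ℝ X)
    (hYc : Convex ℝ Y) {c : ℝ} (h : ∀ x ∈ X, ∃ y ∈ Y, f x y < c) :
    ∃ y ∈ Y, ∀ x ∈ X, f x y < c := by
  -- Compactness of `X` leaves finitely many y to consider, so `Y` need not be compact: the finite
  -- form of Sion's theorem applies to -f.
  obtain ⟨s, hs⟩ := hX.elim_finite_subcover (fun y : Y => {x | f x y < c})
    (fun y => isOpen_lt (hf1 y) continuous_const) (fun x hx => by
      obtain ⟨y, hy, hxy⟩ := h x hx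
      exact Set.mem_iUnion.mpr ⟨⟨y, hy⟩, hxy⟩)
  obtain ⟨y, hy, hlt⟩ := Sion.exists_lt_iInf_of_lt_iInf_of_finite (X := X) (Y := Y)
    (f := fun x y => -(f x y)) (t := -c) hXne hX
    (fun y _ => (hf1 y).neg.lowerSemicontinuous.lowerSemicontinuousOn X)
    (fun y _ => by
      have : ConvexOn ℝ X fun x => -(f x y) := by
        refine ⟨hXc, fun x _ x' _ a b _ _ _ => ?_⟩
        simp only [map_add, map_smul, LinearMap.add_apply, LinearMap.smul_apply, smul_eq_mul]
        linarith
      exact this.quasiconvexOn)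
    hYc
    (fun x _ => (hf2 x).neg.upperSemicontinuous.upperSemicontinuousOn Y)
    (fun x _ => by
      have : ConcaveOn ℝ Y fun y => -(f x y) := by
        refine ⟨hYc, fun y _ y' _ a b _ _ _ => ?_⟩
        simp only [map_add, map_smul, smul_eq_mul]
        linarith
      exact this.quasiconcaveOn)
    hXc (s := Subtype.val '' (s : Set Y)) (s.finite_toSet.image _)
    (by rintro _ ⟨y, -, rfl⟩; exact y.2)
    (fun x hx => by
      obtain ⟨y, hy, hxy⟩ := Set.mem_iUnion₂.mp (hs hx)
      exact ⟨y, ⟨y, hy, rfl⟩, neg_lt_neg hxy⟩)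
  exact ⟨y, hy, fun x hx => neg_lt_neg_iff.mp (hlt x hx)⟩

/-- The real bilinear form `(Y, X) ↦ tr (Y Rᴴ (N ⊗ X) R)`. -/
def pairing (N : Matrix A A ℂ) (R : Matrix (A × B) C ℂ) :
    Matrix C C ℂ →ₗ[ℝ] Matrix B B ℂ →ₗ[ℝ] ℝ :=
  LinearMap.mk₂ ℝ (fun Y X => (Y * (Rᴴ * (N ⊗ₖ X) * R)).trace.re)
    (by intro Y Y' X; simp [Matrix.add_mul])
    (by intro a Y X; simp)
    (by intro Y X X'; simp [kronecker_add, Matrix.mul_add, Matrix.add_mul])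
    (by intro a Y X; simp [kronecker_smul])

lemma pairing_apply (N : Matrix A A ℂ) (R : Matrix (A × B) C ℂ) (Y : Matrix C C ℂ)
    (X : Matrix B B ℂ) : pairing N R Y X = (Y * (Rᴴ * (N ⊗ₖ X) * R)).trace.re := rfl

lemma convexOn_neg_rpow {q : ℝ} (hq : 0 < q) : ConvexOn ℝ (Set.Ioi (0 : ℝ)) fun x => x ^ (-q) := by
  refine ⟨convex_Ioi 0, fun x hx y hy a b ha hb hab => ?_⟩
  have hx' : (0 : ℝ) < x := hx
  have hy' : (0 : ℝ) < y := hy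
  have hxy : (0 : ℝ) < a • x + b • y := convex_Ioi (0 : ℝ) hx hy ha hb hab
  have hlog := strictConcaveOn_log_Ioi.concaveOn.2 hx hy ha hb hab
  have hexp := convexOn_exp.2 (Set.mem_univ (Real.log x * -q)) (Set.mem_univ (Real.log y * -q))
    ha hb hab
  simp only [smul_eq_mul] at hlog hexp hxy ⊢
  rw [Real.rpow_def_of_pos hx', Real.rpow_def_of_pos hy', Real.rpow_def_of_pos hxy]
  refine le_trans (Real.exp_le_exp.mpr ?_) hexp
  nlinarith

lemma continuous_pairing_left (N : Matrix A A ℂ) (R : Matrix (A × B) C ℂ) (X : Matrix B B ℂ) :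
    Continuous fun Y => pairing N R Y X := by
  simp only [pairing_apply]
  refine Complex.continuous_re.comp ?_
  fun_prop

lemma continuous_pairing_right (N : Matrix A A ℂ) (R : Matrix (A × B) C ℂ) (Y : Matrix C C ℂ) :
    Continuous (pairing N R Y) :=
  LinearMap.continuous_of_finiteDimensional _

/-- The infimum of `tr (X W)` over `X = σ ^ (-t)` is bounded by the reverse Hölder value. -/
lemma exists_re_trace_mul_lt {W : Matrix B B ℂ} (hW : W.PosSemidef) [Nonempty B] {t c : ℝ}
    (ht : 0 < t) (hc : powTrace (1 / (1 + t)) W ^ (1 + t) < c) :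
    ∃ X ∈ {X : Matrix B B ℂ | X.PosDef} ∩ traceBall fun x => x ^ (-(1 / t)),
      (X * W).trace.re < c := by
  obtain ⟨V, w, hV, rfl, hw⟩ := exists_eq_conjDiag_of_posSemidef hW
  rw [powTrace_conjDiag hV] at hc
  set p := 1 / (1 + t) with hp
  have hp0 : 0 < p := by positivity
  -- `W` may be singular while `X` must be invertible, so its eigenvalues are shifted by a small ε,
  -- which the strict bound allows.
  have hcont : Continuous fun ε : ℝ => (∑ i, (w i + ε) ^ p) ^ (1 + t) := by
    refine Continuous.rpow_const ?_ fun _ => Or.inr (by linarith)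
    refine continuous_finsetSum _ fun i _ => ?_
    exact Continuous.rpow_const (by fun_prop) fun _ => Or.inr hp0.le
  have h0 : (∑ i, (w i + 0) ^ p) ^ (1 + t) < c := by simpa using hc
  obtain ⟨ε, hεpos, hε⟩ : ∃ ε > 0, (∑ i, (w i + ε) ^ p) ^ (1 + t) < c := by
    have hev := (hcont.continuousAt.eventually (gt_mem_nhds h0)).filter_mono
      (nhdsWithin_le_nhds (s := Set.Ioi 0))
    obtain ⟨ε, h1, h2⟩ := (hev.and self_mem_nhdsWithin).exists
    exact ⟨ε, h2, h1⟩
  have hwε : ∀ i, 0 < w i + ε := fun i => by linarith [hw i]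
  set q := ∑ i, (w i + ε) ^ p with hq
  have hqpos : 0 < q := Finset.sum_pos (fun i _ => Real.rpow_pos_of_pos (hwε i) _)
    Finset.univ_nonempty
  -- The equality case of reverse Hölder for the shifted eigenvalues.
  set σ : B → ℝ := fun i => (w i + ε) ^ p / q with hσ
  have hσpos : ∀ i, 0 < σ i := fun i => div_pos (Real.rpow_pos_of_pos (hwε i) _) hqpos
  have hx : ∀ i, 0 < σ i ^ (-t) := fun i => Real.rpow_pos_of_pos (hσpos i) _
  refine ⟨conjDiag V fun i => σ i ^ (-t), ⟨?_, ?_⟩, ?_⟩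
  · refine PosDef.mul_mul_conjTranspose_same ?_ ?_
    · rw [posDef_diagonal_iff]
      intro i
      exact_mod_cast hx i
    · intro x y hxy
      have := congrArg (fun v => v ᵥ* Vᴴ) hxy
      simpa [vecMul_vecMul, mul_eq_one_comm.mp hV] using this
  · refine conjDiag_mem_traceBall (convexOn_neg_rpow (one_div_pos.mpr ht)) hV (fun i => hx i) ?_
    have h1 : ∀ i, (σ i ^ (-t)) ^ (-(1 / t)) = σ i := by
      intro i
      rw [← Real.rpow_mul (hσpos i).le]
      have : -t * -(1 / t) = 1 := by field_simp
      rw [this, Real.rpow_one]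
    simp only [h1]
    rw [hσ, ← Finset.sum_div, div_self hqpos.ne']
  · rw [conjDiag_mul_conjDiag hV, trace_conjDiag hV, Complex.ofReal_re]
    refine lt_of_le_of_lt ?_ hε
    calc ∑ i, σ i ^ (-t) * w i ≤ ∑ i, σ i ^ (-t) * (w i + ε) :=
          Finset.sum_le_sum fun i _ => mul_le_mul_of_nonneg_left (by linarith) (hx i).le
      _ = ∑ i, q ^ t * (w i + ε) ^ p := by
          refine Finset.sum_congr rfl fun i _ => ?_
          rw [hσ]
          dsimp only
          rw [Real.div_rpow (Real.rpow_nonneg (hwε i).le _) hqpos.le, ← Real.rpow_mul (hwε i).le,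
            Real.rpow_neg hqpos.le, div_inv_eq_mul]
          have h2 : (w i + ε) ^ (p * -t) * (w i + ε) = (w i + ε) ^ p := by
            nth_rewrite 2 [← Real.rpow_one (w i + ε)]
            rw [← Real.rpow_add (hwε i)]
            congr 1
            rw [hp]
            field_simp
            ring
          calc _ = q ^ t * ((w i + ε) ^ (p * -t) * (w i + ε)) := by ring
            _ = _ := by rw [h2]
      _ = q ^ (1 + t) := by
          rw [← Finset.mul_sum, ← hq, add_comm, Real.rpow_add hqpos, Real.rpow_one]

/-- Duality of Schatten norms: the `1 / (1 - t)`-norm of `G` is attained in the unit ball of index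
`1 / t`. -/
lemma exists_re_trace_mul_eq {G : Matrix C C ℂ} (hG : G.PosSemidef) {t : ℝ}
    (ht : t ∈ Set.Ioo (0 : ℝ) 1) :
    ∃ Y ∈ {Y : Matrix C C ℂ | Y.PosSemidef} ∩ traceBall fun x => x ^ (1 / t),
      (Y * G).trace.re = powTrace (1 / (1 - t)) G ^ (1 - t) := by
  obtain ⟨ht0, ht1⟩ := ht
  have h1t : 0 < 1 - t := by linarith
  obtain ⟨V, γ, hV, rfl, hγ⟩ := exists_eq_conjDiag_of_posSemidef hG
  rw [powTrace_conjDiag hV]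
  set p := 1 / (1 - t) with hp
  have hp0 : 0 < p := by positivity
  set T := ∑ i, γ i ^ p with hT
  have hTnn : 0 ≤ T := Finset.sum_nonneg fun i _ => Real.rpow_nonneg (hγ i) _
  have hpt : p * t ≠ 0 := by positivity
  -- The equality case of Hölder; when T = 0, division by zero makes y = 0, which also works.
  set y : C → ℝ := fun i => γ i ^ (p * t) / T ^ t with hy
  have hynn : ∀ i, 0 ≤ y i :=
    fun i => div_nonneg (Real.rpow_nonneg (hγ i) _) (Real.rpow_nonneg hTnn _)
  refine ⟨conjDiag V y, ⟨conjDiag_posSemidef V hynn, ?_⟩, ?_⟩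
  · refine conjDiag_mem_traceBall (convexOn_rpow ?_) hV (fun i => hynn i) ?_
    · rw [le_div_iff₀ ht0]
      linarith
    · have h1 : ∀ i, y i ^ (1 / t) = γ i ^ p / T := by
        intro i
        rw [hy]
        dsimp only
        rw [Real.div_rpow (Real.rpow_nonneg (hγ i) _) (Real.rpow_nonneg hTnn _),
          ← Real.rpow_mul (hγ i), ← Real.rpow_mul hTnn, mul_assoc, mul_one_div_cancel ht0.ne',
          mul_one, Real.rpow_one]
      simp only [h1]
      rw [← Finset.sum_div]
      exact div_self_le_one _
  · rw [conjDiag_mul_conjDiag hV, trace_conjDiag hV, Complex.ofReal_re]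
    have h2 : ∀ i, y i * γ i = γ i ^ p / T ^ t := by
      intro i
      rw [hy]
      dsimp only
      rw [div_mul_eq_mul_div]
      congr 1
      nth_rewrite 2 [← Real.rpow_one (γ i)]
      have h3 : p * t + 1 = p := by
        rw [hp]
        field_simp
        ring
      rw [← Real.rpow_add' (hγ i) (by rw [h3]; exact hp0.ne'), h3]
    simp only [h2]
    rw [← Finset.sum_div, ← hT]
    rcases hTnn.eq_or_lt with h | h
    · rw [← h, Real.zero_rpow h1t.ne', zero_div]
    · rw [Real.rpow_sub h, Real.rpow_one]

/-- The minimax step: a bound on all dual quantities is a bound on `renyiNorm` for some invertible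
state. -/
lemma exists_renyiNorm_le [Nonempty B] {M : Matrix A A ℂ} (hM : M.PosSemidef)
    {R : Matrix (A × B) C ℂ} {t c : ℝ} (ht : t ∈ Set.Ioo (0 : ℝ) 1)
    (h : ∀ τ : Matrix C C ℂ, τ.PosSemidef → τ.trace.re ≤ 1 → dualNorm M R τ t < c) :
    ∃ (V : Matrix B B ℂ) (b : B → ℝ), Vᴴ * V = 1 ∧ (∀ j, 0 < b j) ∧ ∑ j, b j = 1 ∧
      renyiNorm (M ⊗ₖ conjDiag V b) R (-t) ≤ c := by
  have ht0 : 0 < t := ht.1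
  have hpt : 1 ≤ 1 / t := by
    rw [le_div_iff₀ ht0]
    linarith [ht.2]
  set N := mpow M (-t) with hN
  have hNpsd : N.PosSemidef := mpow_posSemidef hM _
  have hc0 : 0 < c := lt_of_le_of_lt
    (renyiNorm_nonneg (dual_posSemidef hM PosSemidef.zero) (reshape R) t)
    (h 0 PosSemidef.zero (by simp))
  -- In the variables Y = τ^t and X = σ^(-t) the pairing is bilinear, and tr τ ≤ 1, tr σ ≤ 1 become
  -- the convex constraints tr Y^(1/t) ≤ 1, tr X^(-1/t) ≤ 1.
  obtain ⟨X, ⟨hX, hX1⟩, hlt⟩ := exists_forall_lt_of_forall_exists_lt (pairing N R)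
    (continuous_pairing_left N R) (continuous_pairing_right N R)
    (isCompact_posSemidef_inter_traceBall_rpow hpt)
    ⟨0, PosSemidef.zero, fun U _ => by
      simp [inv_eq_zero, ht0.ne']⟩
    (convex_inter_traceBall (convexOn_rpow hpt) convex_posSemidef
      fun Y hY U _ i => posSemidef_conj_diag_re hY U i)
    (convex_inter_traceBall (S := {X : Matrix B B ℂ | X.PosDef})
      (convexOn_neg_rpow (one_div_pos.mpr ht0)) convex_posDef
      fun Y hY U hU i => posDef_conj_diag_re hY hU i)
    (c := c) (by
      rintro Y ⟨hY, hY1⟩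
      have hYpsd : Y.PosSemidef := hY
      have hτ1 : (mpow Y (1 / t)).trace.re ≤ 1 := by
        obtain ⟨U, y, hU, rfl, hy⟩ := exists_eq_conjDiag_of_posSemidef hYpsd
        rw [mpow_conjDiag hU, trace_conjDiag hU, Complex.ofReal_re]
        exact sum_le_one_of_mem_traceBall hU hY1
      have h1 := h _ (mpow_posSemidef hYpsd (1 / t)) hτ1
      rw [dualNorm, renyiNorm, mpow_dual hM (mpow_posSemidef hYpsd _), mpow_mpow hYpsd,
        one_div_mul_cancel ht0.ne', mpow_one hYpsd] at h1
      obtain ⟨X, hX, hlt⟩ := exists_re_trace_mul_lt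
        ((hNpsd.transpose.kronecker hYpsd).conjTranspose_mul_mul_same (reshape R)) ht0 h1
      refine ⟨X, hX, ?_⟩
      rw [pairing_apply, trace_mul_kronecker_eq]
      exact hlt)
  have hXpd : X.PosDef := hX
  obtain ⟨V, x, hV, hXV, hx'⟩ := exists_eq_conjDiag hXpd.1
  have hx : ∀ i, 0 < x i := fun i => by
    rw [hx']
    exact hXpd.eigenvalues_pos i
  set b : B → ℝ := fun i => x i ^ (-(1 / t)) with hb
  have hbpos : ∀ i, 0 < b i := fun i => Real.rpow_pos_of_pos (hx i) _
  set q := ∑ i, b i with hq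
  have hqpos : 0 < q := Finset.sum_pos (fun i _ => hbpos i) Finset.univ_nonempty
  have hq1 : q ≤ 1 := by
    rw [hXV] at hX1
    exact sum_le_one_of_mem_traceBall hV hX1
  refine ⟨V, fun i => b i / q, hV, fun i => div_pos (hbpos i) hqpos, ?_, ?_⟩
  · rw [← Finset.sum_div, div_self hqpos.ne']
  -- Normalising σ rescales σ^(-t) by q^t ≤ 1, which preserves the bound since c > 0.
  · have hσ : mpow (conjDiag V fun i => b i / q) (-t) = q ^ t • X := by
      rw [mpow_conjDiag hV, hXV]
      ext i j
      rw [Matrix.smul_apply, conjDiag_apply, conjDiag_apply, Finset.smul_sum]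
      refine Finset.sum_congr rfl fun k _ => ?_
      have h1 : (b k / q) ^ (-t) = q ^ t * x k := by
        rw [Real.div_rpow (hbpos k).le hqpos.le, Real.rpow_neg hqpos.le, div_inv_eq_mul, hb]
        dsimp only
        rw [← Real.rpow_mul (hx k).le]
        have : -(1 / t) * -t = 1 := by field_simp
        rw [this, Real.rpow_one, mul_comm]
      rw [h1, Complex.real_smul]
      push_cast
      ring
    have hσpsd : (conjDiag V fun i => b i / q).PosSemidef :=
      conjDiag_posSemidef V fun i => (div_pos (hbpos i) hqpos).le
    have hGpsd := renyi_posSemidef (hM.kronecker hσpsd) R (-t)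
    obtain ⟨Y, hY, hYG⟩ := exists_re_trace_mul_eq hGpsd ht
    rw [renyiNorm, ← sub_eq_add_neg, ← hYG, mpow_kronecker hM hσpsd, hσ, ← pairing_apply,
      map_smul, smul_eq_mul]
    have h1 := hlt Y hY
    have hqt0 : 0 < q ^ t := Real.rpow_pos_of_pos hqpos _
    have hqt1 : q ^ t ≤ 1 := Real.rpow_le_one hqpos.le hq1 ht0.le
    nlinarith

end Duality

/-! ### Gluing two convex halves at 0 -/

lemma convexOn_of_convex_halves {f : ℝ → ℝ} (h0 : f 0 = 0)
    (hl : ∀ x y z : ℝ, -1 < x → x < y → y < z → z ≤ 0 →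
      (z - x) * f y ≤ (z - y) * f x + (y - x) * f z)
    (hr : ∀ x y z : ℝ, 0 ≤ x → x < y → y < z → z < 1 →
      (z - x) * f y ≤ (z - y) * f x + (y - x) * f z)
    (hj : ∀ x z : ℝ, -1 < x → x < 0 → 0 < z → z < 1 → 0 ≤ z * f x - x * f z) :
    ConvexOn ℝ (Set.Ioo (-1 : ℝ) 1) f := by
  refine convexOn_of_slope_mono_adjacent (convex_Ioo _ _) ?_
  intro x y z hx hz hxy hyz
  suffices h : (z - x) * f y ≤ (z - y) * f x + (y - x) * f z by
    rw [div_le_div_iff₀ (by linarith) (by linarith)]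
    linarith
  rcases le_or_gt z 0 with hz0 | hz0
  · exact hl x y z hx.1 hxy hyz hz0
  rcases le_or_gt 0 x with hx0 | hx0
  · exact hr x y z hx0 hxy hyz hz.2
  have hjx := hj x z hx.1 hx0 hz0 hz.2
  -- As f 0 = 0, `hj` is the three-point inequality at 0. For y ≠ 0 it is combined with the
  -- inequality on the half containing y, with 0 as an endpoint, after multiplying by the positive
  -- number -x or z.
  rcases lt_trichotomy y 0 with hy | hy | hy
  · have h1 := hl x y 0 hx.1 hxy hy le_rfl
    rw [h0] at h1
    have h2 : (-x) * ((z - x) * f y) ≤ (-x) * ((z - y) * f x + (y - x) * f z) := by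
      have h3 := mul_le_mul_of_nonneg_left h1 (by linarith : 0 ≤ z - x)
      have h4 := mul_nonneg (by linarith : 0 ≤ y - x) hjx
      linarith
    exact le_of_mul_le_mul_left h2 (by linarith)
  · subst hy
    rw [h0]
    linarith
  · have h1 := hr 0 y z le_rfl hy hyz hz.2
    rw [h0] at h1
    have h2 : z * ((z - x) * f y) ≤ z * ((z - y) * f x + (y - x) * f z) := by
      have h3 := mul_le_mul_of_nonneg_left h1 (by linarith : 0 ≤ z - x)
      have h4 := mul_nonneg (by linarith : 0 ≤ z - y) hjx
      linarith
    exact le_of_mul_le_mul_left h2 hz0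

lemma logb_interp {a b c α β : ℝ} (ha : 0 < a) (hb : 0 < b) (hc : 0 < c)
    (h : c ≤ a ^ α * b ^ β) : Real.logb 2 c ≤ α * Real.logb 2 a + β * Real.logb 2 b := by
  have h1 := Real.logb_le_logb_of_le (b := 2) (by norm_num) hc h
  rwa [Real.logb_mul (Real.rpow_pos_of_pos ha _).ne' (Real.rpow_pos_of_pos hb _).ne',
    Real.logb_rpow_eq_mul_logb_of_pos ha, Real.logb_rpow_eq_mul_logb_of_pos hb] at h1

/-! ### The divergence as a logarithm of the norm -/

section General

variable {n : Type*} [Fintype n] [DecidableEq n]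

/-- Here (1-α)/(2α) = -t/2, so the two operators are M Mᴴ and Mᴴ M for M = D^(-t/2) R. -/
lemma renyiNorm_eq_sandwichedTrace {D R ρ : Matrix n n ℂ} (hD : D.PosSemidef) (hR : Rᴴ = R)
    (hρ : R * R = ρ) {t : ℝ} (ht1 : t < 1) (ht0 : t ≠ 0) :
    renyiNorm D R (-t) = sandwichedTrace (1 / (1 - t)) ρ D ^ (1 - t) := by
  have h1t : (1 : ℝ) - t ≠ 0 := by linarith
  have hexp : (1 - 1 / (1 - t)) / (2 * (1 / (1 - t))) = -t / 2 := by
    field_simp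
    ring
  rw [renyiNorm, ← sub_eq_add_neg, sandwichedTrace, hexp, ← powTrace]
  congr 1
  have hDh : (mpow D (-t / 2))ᴴ = mpow D (-t / 2) := (mpow_posSemidef hD _).1
  have h1 : mpow D (-t / 2) * ρ * mpow D (-t / 2)
      = (mpow D (-t / 2) * R) * (mpow D (-t / 2) * R)ᴴ := by
    rw [conjTranspose_mul, hR, hDh, ← hρ]
    simp only [Matrix.mul_assoc]
  have h2 : Rᴴ * mpow D (-t) * R = (mpow D (-t / 2) * R)ᴴ * (mpow D (-t / 2) * R) := by
    rw [conjTranspose_mul, hDh, Matrix.mul_assoc, Matrix.mul_assoc, ← Matrix.mul_assoc (mpow D _),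
      mpow_mul_mpow hD (by rw [add_halves]; exact neg_ne_zero.mpr ht0), add_halves]
  rw [h1, h2, powTrace_mul_conjTranspose_comm]

lemma sandwichedDiv_of_feasible {D R ρ : Matrix n n ℂ} (hD : D.PosSemidef) (hR : Rᴴ = R)
    (hρ : R * R = ρ) {t : ℝ} (ht1 : t < 1) (ht0 : t ≠ 0)
    (hf : (0 < t ∧ supp ρ ≤ supp D) ∨ (t < 0 ∧ ¬ supp ρ ⟂ supp D)) :
    sandwichedDiv (1 / (1 - t)) ρ D = ((1 / t * Real.logb 2 (renyiNorm D R (-t)) : ℝ) : EReal) := by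
  have h1t : 0 < 1 - t := by linarith
  have hα1 : 1 / (1 - t) ≠ 1 := by
    intro h
    rw [div_eq_one_iff_eq h1t.ne'] at h
    exact ht0 (by linarith)
  have hcond : (1 < 1 / (1 - t) ∧ supp ρ ≤ supp D) ∨ (1 / (1 - t) < 1 ∧ ¬ supp ρ ⟂ supp D) := by
    rcases hf with ⟨h, h'⟩ | ⟨h, h'⟩
    · exact Or.inl ⟨by rw [lt_div_iff₀ h1t]; linarith, h'⟩
    · exact Or.inr ⟨by rw [div_lt_iff₀ h1t]; linarith, h'⟩
  rw [sandwichedDiv, if_neg hα1, if_pos hcond, renyiNorm_eq_sandwichedTrace hD hR hρ ht1 ht0]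
  congr 1
  have hnn : 0 ≤ sandwichedTrace (1 / (1 - t)) ρ D := by
    refine powTrace_nonneg _ ?_
    have hρ' : ρ.PosSemidef := by
      rw [← hρ]
      nth_rewrite 2 [← hR]
      exact posSemidef_self_mul_conjTranspose R
    have h := hρ'.mul_mul_conjTranspose_same (mpow D ((1 - 1 / (1 - t)) / (2 * (1 / (1 - t)))))
    rwa [(mpow_posSemidef hD _).1.eq] at h
  -- A vanishing trace is harmless, since `Real.logb 2 0 = 0` on both sides.
  rcases hnn.eq_or_lt with h | h
  · rw [← h, Real.zero_rpow h1t.ne']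
    simp
  · rw [Real.logb_rpow_eq_mul_logb_of_pos h, ← mul_assoc]
    congr 1
    have h1 : 1 / (1 - t) - 1 = t / (1 - t) := by
      field_simp
      ring
    rw [h1, one_div_div, div_mul_eq_mul_div, one_mul]

lemma sandwichedDiv_of_not_feasible {D ρ : Matrix n n ℂ} {t : ℝ} (ht1 : t < 1) (ht0 : t ≠ 0)
    (hf : ¬((0 < t ∧ supp ρ ≤ supp D) ∨ (t < 0 ∧ ¬ supp ρ ⟂ supp D))) :
    sandwichedDiv (1 / (1 - t)) ρ D = ⊤ := by
  have h1t : 0 < 1 - t := by linarith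
  have hα1 : 1 / (1 - t) ≠ 1 := by
    intro h
    rw [div_eq_one_iff_eq h1t.ne'] at h
    exact ht0 (by linarith)
  rw [sandwichedDiv, if_neg hα1, if_neg]
  rintro (⟨h, h'⟩ | ⟨h, h'⟩)
  · rw [lt_div_iff₀ h1t] at h
    exact hf (Or.inl ⟨by linarith, h'⟩)
  · rw [div_lt_iff₀ h1t] at h
    exact hf (Or.inr ⟨by linarith, h'⟩)

/-- A vanishing norm forces D^(s/2) R = 0, then D R = 0 and ρ D = 0, so that the supports are
orthogonal. -/
lemma renyiNorm_pos {D R ρ : Matrix n n ℂ} (hD : D.PosSemidef) (hR : Rᴴ = R) (hρ : R * R = ρ)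
    {s : ℝ} (hs0 : 0 < s) (hs1 : s < 1) (ho : ¬ supp ρ ⟂ supp D) : 0 < renyiNorm D R s := by
  refine lt_of_le_of_ne (renyiNorm_nonneg hD R s) fun h0 => ho ?_
  have hρh : ρ.IsHermitian := by rw [← hρ, IsHermitian, conjTranspose_mul, hR]
  refine supp_isOrtho_of_mul_eq_zero hρh ?_
  have hG := renyi_posSemidef hD R s
  have hG0 : Rᴴ * mpow D s * R = 0 := by
    obtain ⟨C, γ, hC, hGC, hγ⟩ := exists_eq_conjDiag_of_posSemidef hG
    rw [renyiNorm, hGC, powTrace_conjDiag hC, eq_comm,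
      Real.rpow_eq_zero (Finset.sum_nonneg fun i _ => Real.rpow_nonneg (hγ i) _) (by linarith),
      Finset.sum_eq_zero_iff_of_nonneg fun i _ => Real.rpow_nonneg (hγ i) _] at h0
    have hγ0 : γ = fun _ => 0 := by
      ext i
      exact ((Real.rpow_eq_zero_iff_of_nonneg (hγ i)).mp (h0 i (Finset.mem_univ i))).1
    rw [hGC, hγ0]
    simp [conjDiag]
  have hDh : (mpow D (s / 2))ᴴ = mpow D (s / 2) := (mpow_posSemidef hD _).1
  have hM : mpow D (s / 2) * R = 0 := by
    rw [← conjTranspose_mul_self_eq_zero, conjTranspose_mul, hDh, Matrix.mul_assoc,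
      ← Matrix.mul_assoc (mpow D _), mpow_mul_mpow hD (by linarith), add_halves,
      ← Matrix.mul_assoc, hG0]
  have hDR : D * R = 0 := by
    have h1 : mpow D (1 - s / 2) * mpow D (s / 2) = D := by
      rw [mpow_mul_mpow hD (by norm_num), sub_add_cancel, mpow_one hD]
    rw [← h1, Matrix.mul_assoc, hM, Matrix.mul_zero]
  have hRD : R * D = 0 := by
    have := congrArg conjTranspose hDR
    rwa [conjTranspose_mul, hR, hD.1.eq, conjTranspose_zero] at this
  rw [← hρ, Matrix.mul_assoc, hRD, Matrix.mul_zero]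

/-- Keeps the supremum for negative t finite: Hölder bounds the trace of Rᴴ D^s R uniformly in `D`,
and x^(1/(1+s)) ≤ 1 + x passes from the trace to the quasi-norm. -/
lemma exists_renyiNorm_bound (R : Matrix n n ℂ) {s : ℝ} (hs : s ∈ Set.Ioo (0 : ℝ) 1) :
    ∃ K : ℝ, ∀ D : Matrix n n ℂ, D.PosSemidef → D.trace.re ≤ 1 → renyiNorm D R s ≤ K := by
  have hs0 : 0 < s := hs.1
  set K₀ := powTrace (1 / (1 - s)) (R * Rᴴ) ^ (1 - s)
  refine ⟨(Fintype.card n + K₀) ^ (1 + s), fun D hD hD1 => ?_⟩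
  have hG := renyi_posSemidef hD R s
  have htr : (Rᴴ * mpow D s * R).trace.re ≤ K₀ := by
    rw [Matrix.mul_assoc, trace_mul_comm, Matrix.mul_assoc]
    exact re_trace_mpow_mul_le hD hD1 (posSemidef_self_mul_conjTranspose R) hs
  refine Real.rpow_le_rpow (powTrace_nonneg _ hG) ?_ (by linarith)
  refine le_trans ?_ (add_le_add_right htr _)
  obtain ⟨C, γ, hC, hGC, hγ⟩ := exists_eq_conjDiag_of_posSemidef hG
  rw [hGC, powTrace_conjDiag hC, trace_conjDiag hC, Complex.ofReal_re]
  have h1 : ∀ i, γ i ^ (1 / (1 + s)) ≤ 1 + γ i := by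
    intro i
    calc γ i ^ (1 / (1 + s)) ≤ (1 + γ i) ^ (1 / (1 + s)) :=
          Real.rpow_le_rpow (hγ i) (by linarith) (by positivity)
      _ ≤ (1 + γ i) ^ (1 : ℝ) := by
          refine Real.rpow_le_rpow_of_exponent_le (by linarith [hγ i]) ?_
          rw [div_le_one (by linarith)]
          linarith
      _ = 1 + γ i := Real.rpow_one _
  calc ∑ i, γ i ^ (1 / (1 + s)) ≤ ∑ i, (1 + γ i) := Finset.sum_le_sum fun i _ => h1 i
    _ = _ := by simp [Finset.sum_add_distrib]

end General

/-! ### Optimisation over the states of B -/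

variable {A B : Type*} [Fintype A] [DecidableEq A] [Fintype B] [DecidableEq B]

lemma trace_margA (ρ : Matrix (A × B) (A × B) ℂ) : (margA ρ).trace = ρ.trace := by
  simp [trace, margA, Fintype.sum_prod_type]

lemma trace_reshape {C : Type*} [Fintype C] [DecidableEq C] (R : Matrix (A × B) C ℂ) :
    ((reshape R)ᴴ * reshape R).trace.re = (Rᴴ * R).trace.re := by
  rw [trace_conjTranspose_mul_self_re, trace_conjTranspose_mul_self_re]
  simp only [reshape, norm_star, Fintype.sum_prod_type]
  rw [Finset.sum_comm]
  rw [Finset.sum_congr rfl fun a _ => Finset.sum_comm]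
  rw [Finset.sum_comm]

/-- The states `σ` of `B` such that `ρ_A ⊗ σ` dominates `ρ`. -/
def dominatingStates (ρ : Matrix (A × B) (A × B) ℂ) : Set (Matrix B B ℂ) :=
  {σ | IsState σ ∧ supp ρ ≤ supp (margA ρ ⊗ₖ σ)}

/-- The states `σ` of `B` such that `ρ_A ⊗ σ` is not orthogonal to `ρ`. -/
def nonorthogonalStates (ρ : Matrix (A × B) (A × B) ℂ) : Set (Matrix B B ℂ) :=
  {σ | IsState σ ∧ ¬ supp ρ ⟂ supp (margA ρ ⊗ₖ σ)}

open Classical in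
/-- The optimal value over `σ` of the norm defining the Rényi mutual information. -/
def optimalNorm (ρ R : Matrix (A × B) (A × B) ℂ) (t : ℝ) : ℝ :=
  if t = 0 then 1
  else if 0 < t then sInf ((fun σ => renyiNorm (margA ρ ⊗ₖ σ) R (-t)) '' dominatingStates ρ)
  else sSup ((fun σ => renyiNorm (margA ρ ⊗ₖ σ) R (-t)) '' nonorthogonalStates ρ)

lemma IsState.kronecker {ρ : Matrix (A × B) (A × B) ℂ} (hρ : IsState ρ) {σ : Matrix B B ℂ}
    (hσ : IsState σ) : IsState (margA ρ ⊗ₖ σ) :=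
  ⟨(margA_posSemidef hρ.1).kronecker hσ.1, by rw [trace_kronecker, trace_margA, hρ.2, hσ.2, one_mul]⟩

lemma dominatingStates_subset {ρ : Matrix (A × B) (A × B) ℂ} (hρ : IsState ρ) :
    dominatingStates ρ ⊆ nonorthogonalStates ρ := by
  rintro σ ⟨hσ, h⟩
  refine ⟨hσ, fun ho => ?_⟩
  have h0 := eq_zero_of_supp_isOrtho_of_le h ho
  have := hρ.2
  rw [h0] at this
  simp at this

lemma conjDiag_mem_dominatingStates {ρ : Matrix (A × B) (A × B) ℂ} (hρ : IsState ρ)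
    {V : Matrix B B ℂ} (hV : Vᴴ * V = 1) {b : B → ℝ} (hb : ∀ j, 0 < b j) (hb1 : ∑ j, b j = 1) :
    conjDiag V b ∈ dominatingStates ρ :=
  ⟨⟨conjDiag_posSemidef V fun j => (hb j).le, by rw [trace_conjDiag hV, hb1, Complex.ofReal_one]⟩,
    supp_le_supp_marginal_kronecker hρ.1 hV hb⟩

lemma IsState.nonempty_right {ρ : Matrix (A × B) (A × B) ℂ} (hρ : IsState ρ) : Nonempty B := by
  by_contra h
  rw [not_nonempty_iff] at h
  have := hρ.2
  simp [trace] at this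

lemma dominatingStates_nonempty {ρ : Matrix (A × B) (A × B) ℂ} (hρ : IsState ρ) :
    (dominatingStates ρ).Nonempty := by
  have := hρ.nonempty_right
  have hcard : (0 : ℝ) < Fintype.card B := by exact_mod_cast Fintype.card_pos
  refine ⟨_, conjDiag_mem_dominatingStates hρ (V := 1) (b := fun _ => (Fintype.card B : ℝ)⁻¹)
    (by simp) (fun _ => inv_pos.mpr hcard) ?_⟩
  simp [hcard.ne']

/-! ### Log-convexity of the optimal norm -/

section Optimal

variable {ρ R : Matrix (A × B) (A × B) ℂ} (hρ : IsState ρ) (hR : Rᴴ = R) (hRR : R * R = ρ)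

include hρ hR hRR

lemma trace_sqrt_eq_one : (Rᴴ * R).trace.re = 1 := by
  rw [hR, hRR, hρ.2, Complex.one_re]

/-- Log-convexity through s = 0, where the value is tr ρ = 1 because σ dominates. -/
lemma one_le_of_mem_dominatingStates {σ : Matrix B B ℂ} (hσ : σ ∈ dominatingStates ρ) {l u : ℝ}
    (hl : -1 < l) (hl0 : l < 0) (hu0 : 0 < u) (hu : u < 1) :
    1 ≤ renyiNorm (margA ρ ⊗ₖ σ) R (-l) ^ (u / (u - l))
      * renyiNorm (margA ρ ⊗ₖ σ) R (-u) ^ (-l / (u - l)) := by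
  obtain ⟨N, -, hN, -, hN0, hint⟩ := exists_logConvex_renyiNorm (hρ.kronecker hσ.1).1 R
  have h0 : N 0 = 1 := by
    rw [hN0 (by rw [hR, hRR]; exact hσ.2), trace_sqrt_eq_one hρ hR hRR]
  have h := hint (-u) 0 (-l) (by linarith) (by linarith) (by linarith) (by linarith) (by linarith)
  rw [h0, hN _ (by linarith), hN _ (by linarith)] at h
  have e1 : (-l - 0) / (-l - -u) = -l / (u - l) := by ring_nf
  have e2 : (0 - -u) / (-l - -u) = u / (u - l) := by ring_nf
  rwa [e1, e2, mul_comm] at h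

lemma renyiNorm_pos_of_mem_dominatingStates {σ : Matrix B B ℂ} (hσ : σ ∈ dominatingStates ρ)
    {u : ℝ} (hu0 : 0 < u) (hu : u < 1) : 0 < renyiNorm (margA ρ ⊗ₖ σ) R (-u) := by
  refine lt_of_le_of_ne (renyiNorm_nonneg (hρ.kronecker hσ.1).1 R _) fun h0 => ?_
  have h := one_le_of_mem_dominatingStates hρ hR hRR hσ (l := -1 / 2) (by norm_num) (by norm_num)
    hu0 hu
  rw [← h0, Real.zero_rpow (ne_of_gt (div_pos (by norm_num) (by linarith))), mul_zero] at h
  linarith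

lemma renyiNorm_pos_of_mem_nonorthogonalStates {σ : Matrix B B ℂ}
    (hσ : σ ∈ nonorthogonalStates ρ) {t : ℝ} (ht : -1 < t) (ht0 : t < 0) :
    0 < renyiNorm (margA ρ ⊗ₖ σ) R (-t) :=
  renyiNorm_pos (hρ.kronecker hσ.1).1 hR hRR (by linarith) (by linarith) hσ.2

lemma bddAbove_renyiNorm {t : ℝ} (ht : -1 < t) (ht0 : t < 0) :
    BddAbove ((fun σ => renyiNorm (margA ρ ⊗ₖ σ) R (-t)) '' nonorthogonalStates ρ) := by
  obtain ⟨K, hK⟩ := exists_renyiNorm_bound R (s := -t) ⟨by linarith, by linarith⟩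
  refine ⟨K, ?_⟩
  rintro _ ⟨σ, hσ, rfl⟩
  have h := hρ.kronecker hσ.1
  exact hK _ h.1 (by rw [h.2, Complex.one_re])

lemma bddBelow_renyiNorm (t : ℝ) :
    BddBelow ((fun σ => renyiNorm (margA ρ ⊗ₖ σ) R (-t)) '' dominatingStates ρ) := by
  refine ⟨0, ?_⟩
  rintro _ ⟨σ, hσ, rfl⟩
  exact renyiNorm_nonneg (hρ.kronecker hσ.1).1 R _

lemma le_optimalNorm {σ : Matrix B B ℂ} (hσ : σ ∈ nonorthogonalStates ρ) {t : ℝ} (ht : -1 < t)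
    (ht0 : t < 0) : renyiNorm (margA ρ ⊗ₖ σ) R (-t) ≤ optimalNorm ρ R t := by
  rw [optimalNorm, if_neg ht0.ne, if_neg ht0.le.not_gt]
  exact le_csSup (bddAbove_renyiNorm hρ hR hRR ht ht0) ⟨σ, hσ, rfl⟩

lemma optimalNorm_le {σ : Matrix B B ℂ} (hσ : σ ∈ dominatingStates ρ) {t : ℝ}
    (ht0 : 0 < t) : optimalNorm ρ R t ≤ renyiNorm (margA ρ ⊗ₖ σ) R (-t) := by
  rw [optimalNorm, if_neg ht0.ne', if_pos ht0]
  exact csInf_le (bddBelow_renyiNorm hρ hR hRR t) ⟨σ, hσ, rfl⟩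

lemma optimalNorm_le_of_forall {t c : ℝ} (ht0 : t < 0)
    (h : ∀ σ ∈ nonorthogonalStates ρ, renyiNorm (margA ρ ⊗ₖ σ) R (-t) ≤ c) :
    optimalNorm ρ R t ≤ c := by
  rw [optimalNorm, if_neg ht0.ne, if_neg ht0.le.not_gt]
  refine csSup_le (((dominatingStates_nonempty hρ).mono (dominatingStates_subset hρ)).image _) ?_
  rintro _ ⟨σ, hσ, rfl⟩
  exact h σ hσ

lemma le_optimalNorm_of_forall {t c : ℝ} (ht0 : 0 < t)
    (h : ∀ σ ∈ dominatingStates ρ, c ≤ renyiNorm (margA ρ ⊗ₖ σ) R (-t)) :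
    c ≤ optimalNorm ρ R t := by
  rw [optimalNorm, if_neg ht0.ne', if_pos ht0]
  refine le_csInf ((dominatingStates_nonempty hρ).image _) ?_
  rintro _ ⟨σ, hσ, rfl⟩
  exact h σ hσ

lemma optimalNorm_pos_of_neg {t : ℝ} (ht : -1 < t) (ht0 : t < 0) : 0 < optimalNorm ρ R t := by
  obtain ⟨σ, hσ⟩ := dominatingStates_nonempty hρ
  have hσ' := dominatingStates_subset hρ hσ
  exact (renyiNorm_pos_of_mem_nonorthogonalStates hρ hR hRR hσ' ht ht0).trans_le
    (le_optimalNorm hρ hR hRR hσ' ht ht0)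

/-- The inequality at 0 for one σ, solved for its value at u. The bound does not depend on σ, so it
passes to the infimum and shows that it is positive. -/
lemma le_optimalNorm_of_pos {l u : ℝ} (hl : -1 < l) (hl0 : l < 0) (hu0 : 0 < u) (hu : u < 1) :
    ((optimalNorm ρ R l ^ (u / (u - l)))⁻¹) ^ ((-l / (u - l))⁻¹) ≤ optimalNorm ρ R u := by
  have hK := Real.rpow_pos_of_pos (optimalNorm_pos_of_neg hρ hR hRR hl hl0) (u / (u - l))
  have he : 0 < -l / (u - l) := div_pos (by linarith) (by linarith)
  refine le_optimalNorm_of_forall hρ hR hRR hu0 fun σ hσ => ?_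
  have h := one_le_of_mem_dominatingStates hρ hR hRR hσ hl hl0 hu0 hu
  have hσ' := dominatingStates_subset hρ hσ
  have hpos := renyiNorm_pos_of_mem_dominatingStates hρ hR hRR hσ hu0 hu
  have h1 : 1 ≤ optimalNorm ρ R l ^ (u / (u - l))
      * renyiNorm (margA ρ ⊗ₖ σ) R (-u) ^ (-l / (u - l)) :=
    h.trans (mul_le_mul_of_nonneg_right
      (Real.rpow_le_rpow (renyiNorm_nonneg (hρ.kronecker hσ.1).1 R _)
        (le_optimalNorm hρ hR hRR hσ' hl hl0) (div_nonneg hu0.le (by linarith)))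
      (Real.rpow_nonneg hpos.le _))
  rw [← inv_le_iff_one_le_mul₀' hK] at h1
  have h2 := Real.rpow_le_rpow (inv_nonneg.mpr hK.le) h1 (inv_nonneg.mpr he.le)
  rwa [← Real.rpow_mul hpos.le, mul_inv_cancel₀ he.ne', Real.rpow_one] at h2

lemma optimalNorm_pos {t : ℝ} (ht : -1 < t) (ht1 : t < 1) : 0 < optimalNorm ρ R t := by
  rcases lt_trichotomy t 0 with h | h | h
  · exact optimalNorm_pos_of_neg hρ hR hRR ht h
  · rw [optimalNorm, if_pos h]
    exact one_pos
  · refine lt_of_lt_of_le ?_ (le_optimalNorm_of_pos hρ hR hRR (l := -1 / 2) (by norm_num)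
      (by norm_num) h ht1)
    exact Real.rpow_pos_of_pos (inv_pos.mpr (Real.rpow_pos_of_pos
      (optimalNorm_pos_of_neg hρ hR hRR (by norm_num) (by norm_num)) _)) _

lemma optimalNorm_junction {l u : ℝ} (hl : -1 < l) (hl0 : l < 0) (hu0 : 0 < u) (hu : u < 1) :
    1 ≤ optimalNorm ρ R l ^ (u / (u - l)) * optimalNorm ρ R u ^ (-l / (u - l)) := by
  have hK := Real.rpow_pos_of_pos (optimalNorm_pos_of_neg hρ hR hRR hl hl0) (u / (u - l))
  have he : 0 < -l / (u - l) := div_pos (by linarith) (by linarith)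
  have h := Real.rpow_le_rpow (Real.rpow_nonneg (inv_nonneg.mpr hK.le) _)
    (le_optimalNorm_of_pos hρ hR hRR hl hl0 hu0 hu) he.le
  rw [← Real.rpow_mul (inv_nonneg.mpr hK.le), inv_mul_cancel₀ he.ne', Real.rpow_one] at h
  rwa [← inv_le_iff_one_le_mul₀' hK]

/-- Interpolation for each σ, followed by the supremum. At u = 0 only N 0 ≤ 1 is available, as a
nonorthogonal σ need not dominate ρ. -/
lemma optimalNorm_interp_left {l s u : ℝ} (hl : -1 < l) (hls : l < s) (hsu : s < u) (hu : u ≤ 0) :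
    optimalNorm ρ R s ≤ optimalNorm ρ R l ^ ((u - s) / (u - l))
      * optimalNorm ρ R u ^ ((s - l) / (u - l)) := by
  refine optimalNorm_le_of_forall hρ hR hRR (by linarith) fun σ hσ => ?_
  obtain ⟨N, hNnn, hN, hN0, -, hint⟩ := exists_logConvex_renyiNorm (hρ.kronecker hσ.1).1 R
  have h := hint (-u) (-s) (-l) (by linarith) (by linarith) (by linarith) (by linarith)
    (by linarith)
  have hNu : N (-u) ≤ optimalNorm ρ R u := by
    rcases hu.eq_or_lt with rfl | hu
    · rw [neg_zero, optimalNorm, if_pos rfl, ← trace_sqrt_eq_one hρ hR hRR]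
      exact hN0
    · rw [hN _ (by linarith)]
      exact le_optimalNorm hρ hR hRR hσ (by linarith) hu
  have hNl : N (-l) ≤ optimalNorm ρ R l := by
    rw [hN _ (by linarith)]
    exact le_optimalNorm hρ hR hRR hσ hl (by linarith)
  have e1 : (-l - -s) / (-l - -u) = (s - l) / (u - l) := by ring_nf
  have e2 : (-s - -u) / (-l - -u) = (u - s) / (u - l) := by ring_nf
  rw [hN _ (by linarith), e1, e2, mul_comm] at h
  refine h.trans (mul_le_mul (Real.rpow_le_rpow (hNnn _) hNl ?_) (Real.rpow_le_rpow (hNnn _) hNu ?_)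
    (Real.rpow_nonneg (hNnn _) _) (Real.rpow_nonneg ((hNnn _).trans hNl) _))
  · exact div_nonneg (by linarith) (by linarith)
  · exact div_nonneg (by linarith) (by linarith)

/-- Every dual norm is log-convex and lies below the optimal norm at l and u, so at s it lies below
the interpolated value; for any larger c the minimax step yields an invertible state of norm at most
c. -/
lemma optimalNorm_interp_right {l s u : ℝ} (hl : 0 ≤ l) (hls : l < s) (hsu : s < u) (hu : u < 1) :
    optimalNorm ρ R s ≤ optimalNorm ρ R l ^ ((u - s) / (u - l))
      * optimalNorm ρ R u ^ ((s - l) / (u - l)) := by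
  have := hρ.nonempty_right
  refine le_of_forall_gt_imp_ge_of_dense fun c hc => ?_
  obtain ⟨V, b, hV, hb, hb1, hle⟩ := exists_renyiNorm_le (margA_posSemidef hρ.1) (R := R)
    (t := s) (c := c) ⟨by linarith, by linarith⟩ (by
      intro τ hτ hτ1
      refine lt_of_le_of_lt ?_ hc
      obtain ⟨N, hNnn, hN, hN0, -, hint⟩ := exists_logConvex_renyiNorm
        (dual_posSemidef (margA_posSemidef hρ.1) hτ) (reshape R)
      have hbound : ∀ t, 0 < t → t < 1 → N t ≤ optimalNorm ρ R t := by
        intro t ht0 ht1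
        rw [hN t ht0.ne']
        refine le_optimalNorm_of_forall hρ hR hRR ht0 fun σ hσ => ?_
        exact dualNorm_le_renyiNorm (margA_posSemidef hρ.1) hσ.1.1
          (by rw [hσ.1.2, Complex.one_re]) hτ hτ1 (by rw [hR, hRR]) hσ.2 ⟨ht0, ht1⟩
      have hNl : N l ≤ optimalNorm ρ R l := by
        rcases hl.eq_or_lt with rfl | hl
        · rw [optimalNorm, if_pos rfl, ← trace_sqrt_eq_one hρ hR hRR, ← trace_reshape]
          exact hN0
        · exact hbound l hl (by linarith)
      have hNu := hbound u (by linarith) hu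
      have h := hint l s u (by linarith) hls.le hsu.le hu (by linarith)
      rw [hN s (by linarith)] at h
      refine h.trans (mul_le_mul (Real.rpow_le_rpow (hNnn _) hNl ?_)
        (Real.rpow_le_rpow (hNnn _) hNu ?_)
        (Real.rpow_nonneg (hNnn _) _) (Real.rpow_nonneg ((hNnn _).trans hNl) _))
      · exact div_nonneg (by linarith) (by linarith)
      · exact div_nonneg (by linarith) (by linarith))
  exact (optimalNorm_le hρ hR hRR (conjDiag_mem_dominatingStates hρ hV hb hb1)
    (by linarith)).trans hle

/-- Infeasible σ contribute ⊤, and x ↦ (1/t) log x is increasing or decreasing with the sign of t.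
Near-optimal σ give the upper bound, so attainment is not needed. -/
lemma sandwichedMI_eq {t : ℝ} (ht : -1 < t) (ht1 : t < 1) (ht0 : t ≠ 0) :
    sandwichedMI (1 / (1 - t)) ρ = ((1 / t * Real.logb 2 (optimalNorm ρ R t) : ℝ) : EReal) := by
  have h1t : 0 < 1 - t := by linarith
  have hα1 : 1 / (1 - t) ≠ 1 := by
    intro h
    rw [div_eq_one_iff_eq h1t.ne'] at h
    exact ht0 (by linarith)
  have hopt := optimalNorm_pos hρ hR hRR ht ht1
  rw [sandwichedMI, if_neg hα1]
  apply le_antisymm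
  · rw [← EReal.le_of_forall_lt_iff_le]
    intro z hz
    rw [EReal.coe_lt_coe_iff] at hz
    rcases lt_or_gt_of_ne ht0 with h | h
    · have hz' : (2 : ℝ) ^ (t * z) < optimalNorm ρ R t := by
        rw [← Real.lt_logb_iff_rpow_lt (by norm_num) hopt]
        have := mul_lt_mul_of_neg_left hz h
        rwa [← mul_assoc, mul_one_div_cancel ht0, one_mul] at this
      obtain ⟨σ, hσ, hlt⟩ : ∃ σ ∈ nonorthogonalStates ρ,
          (2 : ℝ) ^ (t * z) < renyiNorm (margA ρ ⊗ₖ σ) R (-t) := by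
        by_contra! hcon
        exact absurd (optimalNorm_le_of_forall hρ hR hRR h hcon) (not_le.mpr hz')
      refine (iInf₂_le σ hσ.1).trans ?_
      rw [sandwichedDiv_of_feasible (hρ.kronecker hσ.1).1 hR hRR ht1 ht0 (Or.inr ⟨h, hσ.2⟩),
        EReal.coe_le_coe_iff]
      rw [← Real.lt_logb_iff_rpow_lt (by norm_num)
        (renyiNorm_pos_of_mem_nonorthogonalStates hρ hR hRR hσ ht h)] at hlt
      have h1 := mul_le_mul_of_nonpos_left hlt.le (one_div_neg.mpr h).le
      rwa [← mul_assoc, one_div_mul_cancel ht0, one_mul] at h1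
    · have hz' : optimalNorm ρ R t < (2 : ℝ) ^ (t * z) := by
        rw [← Real.logb_lt_iff_lt_rpow (by norm_num) hopt]
        have := mul_lt_mul_of_pos_left hz h
        rwa [← mul_assoc, mul_one_div_cancel ht0, one_mul] at this
      obtain ⟨σ, hσ, hlt⟩ : ∃ σ ∈ dominatingStates ρ,
          renyiNorm (margA ρ ⊗ₖ σ) R (-t) < (2 : ℝ) ^ (t * z) := by
        by_contra! hcon
        exact absurd (le_optimalNorm_of_forall hρ hR hRR h hcon) (not_le.mpr hz')
      refine (iInf₂_le σ hσ.1).trans ?_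
      rw [sandwichedDiv_of_feasible (hρ.kronecker hσ.1).1 hR hRR ht1 ht0 (Or.inl ⟨h, hσ.2⟩),
        EReal.coe_le_coe_iff]
      rw [← Real.logb_lt_iff_lt_rpow (by norm_num)
        (renyiNorm_pos_of_mem_dominatingStates hρ hR hRR hσ h ht1)] at hlt
      rw [one_div, inv_mul_le_iff₀ h]
      exact hlt.le
  · refine le_iInf₂ fun σ hσ => ?_
    by_cases hf : (0 < t ∧ supp ρ ≤ supp (margA ρ ⊗ₖ σ)) ∨
        (t < 0 ∧ ¬ supp ρ ⟂ supp (margA ρ ⊗ₖ σ))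
    · rw [sandwichedDiv_of_feasible (hρ.kronecker hσ).1 hR hRR ht1 ht0 hf, EReal.coe_le_coe_iff]
      rcases hf with ⟨h, hs⟩ | ⟨h, hs⟩
      · refine mul_le_mul_of_nonneg_left ?_ (one_div_pos.mpr h).le
        exact Real.logb_le_logb_of_le (by norm_num) hopt
          (optimalNorm_le hρ hR hRR ⟨hσ, hs⟩ h)
      · refine mul_le_mul_of_nonpos_left ?_ (one_div_neg.mpr h).le
        exact Real.logb_le_logb_of_le (by norm_num)
          (renyiNorm_pos_of_mem_nonorthogonalStates hρ hR hRR ⟨hσ, hs⟩ ht h)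
          (le_optimalNorm hρ hR hRR ⟨hσ, hs⟩ ht h)
    · rw [sandwichedDiv_of_not_feasible ht1 ht0 hf]
      exact le_top

lemma mul_sandwichedMI_eq {t : ℝ} (ht : t ∈ Set.Ioo (-1 : ℝ) 1) :
    t * (sandwichedMI (1 / (1 - t)) ρ).toReal = Real.logb 2 (optimalNorm ρ R t) := by
  -- At 0 the factor t erases the mutual information, so no limit α → 1 has to be computed.
  by_cases ht0 : t = 0
  · rw [optimalNorm, if_pos ht0, Real.logb_one, ht0, zero_mul]
  · rw [sandwichedMI_eq hρ hR hRR ht.1 ht.2 ht0, EReal.toReal_coe, ← mul_assoc,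
      mul_one_div_cancel ht0, one_mul]

lemma convexOn_logb_optimalNorm :
    ConvexOn ℝ (Set.Ioo (-1 : ℝ) 1) fun t => Real.logb 2 (optimalNorm ρ R t) := by
  have hclear : ∀ {x y z a b c : ℝ}, x < z → c ≤ (z - y) / (z - x) * a + (y - x) / (z - x) * b →
      (z - x) * c ≤ (z - y) * a + (y - x) * b := by
    intro x y z a b c hxz h
    have h1 := mul_le_mul_of_nonneg_left h (by linarith : 0 ≤ z - x)
    have hne : z - x ≠ 0 := by linarith
    have h2 : (z - x) * ((z - y) / (z - x) * a + (y - x) / (z - x) * b)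
        = (z - y) * a + (y - x) * b := by
      field_simp
    rwa [h2] at h1
  have hpos : ∀ {t : ℝ}, -1 < t → t < 1 → 0 < optimalNorm ρ R t :=
    fun h h' => optimalNorm_pos hρ hR hRR h h'
  refine convexOn_of_convex_halves ?_ ?_ ?_ ?_
  · rw [optimalNorm, if_pos rfl, Real.logb_one]
  · intro x y z hx hxy hyz hz
    exact hclear (by linarith) (logb_interp (hpos hx (by linarith)) (hpos (by linarith) (by linarith))
      (hpos (by linarith) (by linarith)) (optimalNorm_interp_left hρ hR hRR hx hxy hyz hz))
  · intro x y z hx hxy hyz hz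
    exact hclear (by linarith) (logb_interp (hpos (by linarith) (by linarith))
      (hpos (by linarith) (by linarith)) (hpos (by linarith) (by linarith))
      (optimalNorm_interp_right hρ hR hRR hx hxy hyz hz))
  · intro x z hx hx0 hz0 hz
    have h := logb_interp (hpos hx (by linarith)) (hpos (by linarith) hz) one_pos
      (optimalNorm_junction hρ hR hRR hx hx0 hz0 hz)
    have h1 := hclear (x := x) (y := 0) (z := z) (a := Real.logb 2 (optimalNorm ρ R x))
      (b := Real.logb 2 (optimalNorm ρ R z)) (by linarith) (by simpa using h)
    simp only [mul_zero, sub_zero, zero_sub] at h1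
    linarith

end Optimal

end QInfo

end

theorem mainTheorem8 {A B : Type*} [Fintype A] [DecidableEq A] [Fintype B] [DecidableEq B]
    (ρ : Matrix (A × B) (A × B) ℂ) (hρ : QInfo.IsState ρ) :
    (∀ t ∈ Set.Ioo (-1 : ℝ) 1,
      QInfo.sandwichedMI (1 / (1 - t)) ρ ≠ ⊤ ∧ QInfo.sandwichedMI (1 / (1 - t)) ρ ≠ ⊥) ∧
    ConvexOn ℝ (Set.Ioo (-1 : ℝ) 1)
      (fun t : ℝ => t * (QInfo.sandwichedMI (1 / (1 - t)) ρ).toReal) ∧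
    ContinuousOn (fun t : ℝ => t * (QInfo.sandwichedMI (1 / (1 - t)) ρ).toReal)
      (Set.Ioo (-1 : ℝ) 1) := by
  obtain ⟨R, hR, hRR⟩ := QInfo.exists_sqrt hρ.1
  have hconv : ConvexOn ℝ (Set.Ioo (-1 : ℝ) 1)
      (fun t : ℝ => t * (QInfo.sandwichedMI (1 / (1 - t)) ρ).toReal) :=
    (QInfo.convexOn_logb_optimalNorm hρ hR hRR).congr
      fun t ht => (QInfo.mul_sandwichedMI_eq hρ hR hRR ht).symm
  refine ⟨fun t ht => ?_, hconv, hconv.continuousOn isOpen_Ioo⟩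
  by_cases ht0 : t = 0
  · subst ht0
    rw [QInfo.sandwichedMI, if_pos (by norm_num), QInfo.relEntropy,
      if_pos (QInfo.supp_le_supp_marginals hρ.1)]
    exact ⟨EReal.coe_ne_top _, EReal.coe_ne_bot _⟩
  · rw [QInfo.sandwichedMI_eq hρ hR hRR ht.1 ht.2 ht0]
    exact ⟨EReal.coe_ne_top _, EReal.coe_ne_bot _⟩
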